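/- Let $R$ be a commutative noetherian local ring with maximal ideal $\mathfrak m$, residue field $k$ and depth $t$, and let $\operatorname{mod} R$ be the category of finitely generated $R$-modules; all modules are finitely generated. A full subcategory of $\operatorname{mod} R$ is called *extension-closed* if it is closed under direct summands and extensions, and *resolving* if moreover it contains the projective modules and is closed under syzygies. For a module $M$, let $\operatorname{ext} M$ and $\operatorname{res} M$ be the smallest extension-closed, respectively resolving, subcategory of $\operatorname{mod} R$ containing $M$, and let $\operatorname{add} R$ consist of the direct summands of finite direct sums of copies of $R$. Let $\Omega^n M$ be the $n$-th syzygy of $M$ in a minimal free resolution, and let $\operatorname{Tr} M$ be the cokernel of $d^*\colon F_0^*\to F_1^*$, where $F_1\xrightarrow{d}F_0\to M\to 0$ is a minimal free presentation and $(-)^*=\operatorname{Hom}_R(-,R)$. Let $\mathrm{PD}_0(R)$ be the subcategory of modules that have finite projective dimension and are locally free on $\operatorname{Spec}R\setminus\{\mathfrak m\}$, and for $n\ge 0$ let $\mathrm{PD}_0^n(R)$ be the subcategory of those of projective dimension at most $n$. Then there is a filtration $$\operatorname{add} R=\mathrm{PD}_0^0(R)\subsetneq \mathrm{PD}_0^1(R)\subsetneq\cdots\subsetneq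 \mathrm{PD}_0^t(R)=\mathrm{PD}_0(R)$$ of resolving subcategories of $\operatorname{mod} R$, and these are all the resolving subcategories of $\operatorname{mod} R$ contained in $\mathrm{PD}_0(R)$. Moreover, for each integer $1\le n\le t$ (when $t>0$), $$\mathrm{PD}_0^n(R)=\operatorname{res}(\operatorname{Tr}\Omega^{n-1}k)=\operatorname{ext}\Bigl(R\oplus\bigoplus_{i=0}^{n-1}\operatorname{Tr}\Omega^i k\Bigr).$$ -/

import Mathlib

universe u

open CategoryTheory

noncomputable section

namespace ResolvingSubcat

variable {R : Type u} [CommRing R]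

/-- A full subcategory of `mod R` (given by a property of `R`-modules that holds only for finitely
generated ones) that is closed under direct summands and extensions. -/
structure IsExtensionClosed (P : ObjectProperty (ModuleCat.{u} R)) : Prop where
  le_isFG : P ≤ ModuleCat.isFG R
  retracts : P.IsStableUnderRetracts
  extensions : P.IsClosedUnderExtensions

/-- A resolving subcategory of `mod R`: a full subcategory of `mod R` that contains the (finitely
generated) projective modules and is closed under direct summands, extensions and syzygies,
i.e. kernels of surjections from finitely generated projective modules. -/
structure IsResolving (P : ObjectProperty (ModuleCat.{u} R)) : Prop
    extends IsExtensionClosed P where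
  projectives : ∀ F : ModuleCat.{u} R, Module.Finite R F → Module.Projective R F → P F
  syzygies : ∀ S : ShortComplex (ModuleCat.{u} R), S.ShortExact →
    Module.Finite R S.X₂ → Module.Projective R S.X₂ → P S.X₃ → P S.X₁

/-- The extension closure `ext M`: the smallest extension-closed subcategory of `mod R`
containing `M`. -/
def extClosure (M : ModuleCat.{u} R) : ObjectProperty (ModuleCat.{u} R) :=
  fun N => ∀ P : ObjectProperty (ModuleCat.{u} R), IsExtensionClosed P → P M → P N

/-- The resolving closure `res M`: the smallest resolving subcategory of `mod R`
containing `M`. -/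
def resClosure (M : ModuleCat.{u} R) : ObjectProperty (ModuleCat.{u} R) :=
  fun N => ∀ P : ObjectProperty (ModuleCat.{u} R), IsResolving P → P M → P N

/-- `add M`: the direct summands of finite direct sums of copies of `M`. -/
def addClosure (M : ModuleCat.{u} R) : ObjectProperty (ModuleCat.{u} R) :=
  fun N => ∃ n : ℕ, Nonempty (Retract N (ModuleCat.of R (Fin n → M)))

/-- The free module on a generating set of `M` of minimal cardinality. -/
abbrev MinCover (M : ModuleCat.{u} R) : Type u :=
  (⊤ : Submodule R M).generators →₀ R

/-- The surjection onto `M` from the free module on a minimal generating set. When `R` is local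
and `M` is finitely generated, this is the minimal free cover of `M`. -/
def minCover (M : ModuleCat.{u} R) : MinCover M →ₗ[R] M :=
  Finsupp.linearCombination R Subtype.val

/-- The (first) syzygy `Ω M`, the kernel of the minimal free cover of `M`. -/
def syz (M : ModuleCat.{u} R) : ModuleCat.{u} R :=
  ModuleCat.of R (LinearMap.ker (minCover M))

/-- The `n`-th syzygy `Ωⁿ M`, computed with a minimal free resolution of `M`. -/
def nsyz : ℕ → ModuleCat.{u} R → ModuleCat.{u} R
  | 0, M => M
  | n + 1, M => syz (nsyz n M)

/-- The map `d : F₁ → F₀` in a minimal free presentation `F₁ → F₀ → M → 0`. -/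
def minPres (M : ModuleCat.{u} R) : MinCover (syz M) →ₗ[R] MinCover M :=
  (LinearMap.ker (minCover M)).subtype ∘ₗ minCover (syz M)

/-- The (Auslander) transpose `Tr M`, the cokernel of `d* : F₀* → F₁*`, where
`F₁ → F₀ → M → 0` is a minimal free presentation with first map `d`. -/
def transp (M : ModuleCat.{u} R) : ModuleCat.{u} R :=
  ModuleCat.of R (Module.Dual R (MinCover (syz M)) ⧸ LinearMap.range (minPres M).dualMap)

section Local

variable (R) [IsLocalRing R]

/-- The residue field `k` of the local ring `R`, as an `R`-module. -/
abbrev resField : ModuleCat.{u} R := ModuleCat.of R (IsLocalRing.ResidueField R)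

/-- The depth of the local ring `R`: the supremum of the lengths of the `R`-regular sequences in
the maximal ideal. -/
def ringDepth : ℕ∞ :=
  sSup {d : ℕ∞ | ∃ rs : List R, RingTheory.Sequence.IsRegular R rs ∧
    (∀ r ∈ rs, r ∈ IsLocalRing.maximalIdeal R) ∧ d = rs.length}

/-- `M` is locally free on the punctured spectrum `Spec R \ {𝔪}`. -/
def LocFreePunctured {R : Type u} [CommRing R] [IsLocalRing R] (M : ModuleCat.{u} R) : Prop :=
  ∀ p : PrimeSpectrum R, p ≠ IsLocalRing.closedPoint R → p ∈ Module.freeLocus R M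

/-- `PD₀ⁿ(R)`: finitely generated modules of projective dimension at most `n` that are locally free
on the punctured spectrum. -/
def PDZeroLE (n : ℕ) : ObjectProperty (ModuleCat.{u} R) :=
  fun M => Module.Finite R M ∧ HasProjectiveDimensionLE M n ∧ LocFreePunctured M

/-- `PD₀(R)`: finitely generated modules of finite projective dimension that are locally free
on the punctured spectrum. -/
def PDZero : ObjectProperty (ModuleCat.{u} R) :=
  fun M => Module.Finite R M ∧ projectiveDimension M ≠ ⊤ ∧ LocFreePunctured M

end Local

end ResolvingSubcat

end

/-! Put `T_0 = R` and `T_{j+1} = Tr Ω^j k`. Since `Ext^i(k, R) = 0` for `i < t`, the dual of the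
minimal free resolution of `k` stays exact in degrees below `t`, which yields exact sequences `0 →
T_j → G → T_{j+1} → 0` with `G` free, for `j < t` (`transpSeq_exact`). Hence for `1 ≤ j ≤ t` the
module `T_j` has projective dimension `j`, `Ext^i(T_j, R) = 0` for `0 < i < j`, and `Ext^j(T_j, R)`
is simple. Local freeness on the punctured spectrum is handled as `ExtPowerTorsion`, which passes
through long exact sequences.

Generation by extensions: let `M` lie in `PD₀ⁿ`, `n ≤ t`, and let `Ext^{j+1}(M, R)` be its first
nonzero positive `Ext`. A socle element `e` of it is pulled back from `T_{j+1}` along some `M →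
T_{j+1}`. Adding a free module `F` makes this map surjective; its kernel `K` has the same vanishing
below, and `Ext^{j+1}(K, R)` is a quotient of `Ext^{j+1}(M, R)` in which `e` dies
(`exists_socle_reduction`). Noetherian induction ends at a projective module, and `M` is a summand
of an extension of `T_{j+1}` by `K` (`IsExtensionClosed.pdZeroLE_le`).

Conversely, suppose a resolving subcategory contains `M` in `PD₀ⁿ` of projective dimension exactly
`n ≥ 1`. By induction applied to `Ω M` it contains `PD₀ⁿ⁻¹`. A map `T_n → M` surjective on `Ext^n(-,
R)`, made surjective by a free summand, has kernel in `PD₀ⁿ⁻¹`, so `T_n` belongs to the subcategory,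
and then so does all of `PD₀ⁿ` (`IsResolving.pdZeroLE_le`). The Auslander–Buchsbaum inequality
bounds `n` by `t`. -/

namespace ResolvingSubcat

open Abelian Limits IsLocalRing

/-! ### Dimension shifting and `Ext` into the ring -/

section ExtBasics

variable {R : Type u} [CommRing R]

/-- A morphism between the first two terms of two short exact sequences induces a morphism between
the third terms, compatible with the extension classes. -/
lemma exists_map_X₃ {S S' : ShortComplex (ModuleCat.{u} R)} (hS : S.ShortExact)
    (hS' : S'.ShortExact) (φ : S.X₁ ⟶ S'.X₁) (ψ : S.X₂ ⟶ S'.X₂) (w : φ ≫ S'.f = S.f ≫ ψ) :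
    ∃ f₃ : S.X₃ ⟶ S'.X₃, hS.extClass.comp (Ext.mk₀ φ) (add_zero 1) =
      (Ext.mk₀ f₃).comp hS'.extClass (zero_add 1) := by
  have := hS.epi_g
  have hz : S.f ≫ ψ ≫ S'.g = 0 := by rw [← reassoc_of% w]; simp
  let F : S ⟶ S' := ⟨φ, ψ, hS.exact.desc (ψ ≫ S'.g) hz, w, by simp⟩
  exact ⟨F.τ₃, ShortComplex.ShortExact.extClass_naturality hS hS' F⟩

lemma extClass_comp_injective {S : ShortComplex (ModuleCat.{u} R)} (hS : S.ShortExact)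
    (Y : ModuleCat.{u} R) [Projective S.X₂] {n m : ℕ} (h : 1 + (n + 1) = m)
    {x : Ext S.X₁ Y (n + 1)} (hx : hS.extClass.comp x h = 0) : x = 0 := by
  obtain ⟨y, rfl⟩ := Ext.contravariant_sequence_exact₁ hS Y x h hx
  rw [Ext.eq_zero_of_projective y, Ext.comp_zero]

lemma extClass_comp_surjective {S : ShortComplex (ModuleCat.{u} R)} (hS : S.ShortExact)
    (Y : ModuleCat.{u} R) [Projective S.X₂] {n m : ℕ} (h : 1 + n = m)
    (x : Ext S.X₃ Y m) : ∃ y : Ext S.X₁ Y n, hS.extClass.comp y h = x := by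
  obtain rfl : m = n + 1 := by omega
  exact Ext.contravariant_sequence_exact₃ hS Y x (Ext.eq_zero_of_projective _) h

lemma ext_X₃_eq_zero_iff {S : ShortComplex (ModuleCat.{u} R)} (hS : S.ShortExact)
    (Y : ModuleCat.{u} R) [Projective S.X₂] (n : ℕ) :
    (∀ x : Ext S.X₃ Y (n + 2), x = 0) ↔ ∀ x : Ext S.X₁ Y (n + 1), x = 0 := by
  refine ⟨fun h x ↦ extClass_comp_injective hS Y (m := n + 2) (by omega) (h _), fun h x ↦ ?_⟩
  obtain ⟨y, rfl⟩ := extClass_comp_surjective hS Y (n := n + 1) (by omega) x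
  rw [h y, Ext.comp_zero]

lemma ext_one_eq_zero_iff {S : ShortComplex (ModuleCat.{u} R)} (hS : S.ShortExact)
    (Y : ModuleCat.{u} R) [Projective S.X₂] :
    (∀ x : Ext S.X₃ Y 1, x = 0) ↔ ∀ f : S.X₁ ⟶ Y, ∃ g : S.X₂ ⟶ Y, S.f ≫ g = f := by
  constructor
  · intro h f
    obtain ⟨y, hy⟩ := Ext.contravariant_sequence_exact₁ hS Y (Ext.mk₀ f) (add_zero 1) (h _)
    obtain ⟨g, rfl⟩ := (Ext.mk₀_bijective _ _).2 y
    rw [Ext.mk₀_comp_mk₀] at hy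
    exact ⟨g, (Ext.mk₀_bijective _ _).1 hy⟩
  · intro h x
    obtain ⟨y, rfl⟩ := extClass_comp_surjective hS Y (add_zero 1) x
    obtain ⟨f, rfl⟩ := (Ext.mk₀_bijective _ _).2 y
    obtain ⟨g, rfl⟩ := h f
    rw [← Ext.mk₀_comp_mk₀, hS.extClass_comp_assoc]

/-- The dimension shift isomorphism. -/
noncomputable def extShift {S : ShortComplex (ModuleCat.{u} R)} (hS : S.ShortExact)
    (Y : ModuleCat.{u} R) [Projective S.X₂] (n : ℕ) :
    Ext S.X₁ Y (n + 1) ≃ₗ[R] Ext S.X₃ Y (n + 2) :=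
  LinearEquiv.ofBijective (hS.extClass.precompOfLinear R Y (by omega : 1 + (n + 1) = n + 2))
    ⟨(injective_iff_map_eq_zero _).2 fun _ hx ↦ extClass_comp_injective hS Y (by omega) hx,
      fun x ↦ extClass_comp_surjective hS Y (by omega) x⟩

/-- Vanishing of `Ext` into `R` passes to finitely generated projective modules. -/
lemma ext_projective_eq_zero {M : ModuleCat.{u} R} {n : ℕ}
    (h : ∀ x : Ext M (ModuleCat.of R R) n, x = 0) (F : ModuleCat.{u} R) [Module.Finite R F]
    [Module.Projective R F] (x : Ext M F n) : x = 0 := by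
  obtain ⟨m, f, g, hf, hg, hfg⟩ := Module.Finite.exists_comp_eq_id_of_projective R F
  have key : ∀ i : Fin m, x.comp (Ext.mk₀ (ModuleCat.ofHom (LinearMap.proj i ∘ₗ g)))
      (add_zero n) = 0 := fun i ↦ h _
  have hid : 𝟙 F = ∑ i : Fin m, ModuleCat.ofHom (LinearMap.proj i ∘ₗ g) ≫
      ModuleCat.ofHom (f ∘ₗ LinearMap.single R (fun _ ↦ R) i) := by
    ext z
    have : f (g z) = z := by simpa using congr($hfg z)
    simp only [ModuleCat.hom_id, LinearMap.id_coe, id_eq, ModuleCat.hom_sum]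
    conv_lhs => rw [← this, ← Finset.univ_sum_single (g z)]
    simp
  rw [← x.comp_mk₀_id, hid, Ext.mk₀_sum, Ext.comp_sum]
  refine Finset.sum_eq_zero fun i _ ↦ ?_
  rw [← Ext.mk₀_comp_mk₀, ← Ext.comp_assoc_of_third_deg_zero, key, Ext.zero_comp]

/-- A finitely generated module `M` of projective dimension at most `n + 1` with
`Ext^{n+1}(M, R) = 0` has projective dimension at most `n`. -/
lemma hasProjectiveDimensionLE_of_ext_eq_zero [IsNoetherianRing R] {M : ModuleCat.{u} R}
    [Module.Finite R M] {n : ℕ} (hM : HasProjectiveDimensionLE M (n + 1))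
    (h : ∀ x : Ext M (ModuleCat.of R R) (n + 1), x = 0) : HasProjectiveDimensionLE M n := by
  refine ModuleCat.hasProjectiveDimensionLT_of_forall_finite M (n + 1) fun L _ ↦
    subsingleton_of_forall_eq 0 fun x ↦ ?_
  obtain ⟨m, f, hf⟩ := Module.Finite.exists_fin' R L
  have hf' : Function.Surjective (f ∘ₗ (LinearEquiv.funCongrLeft R R Equiv.ulift :
      (Fin m → R) ≃ₗ[R] (ULift.{u} (Fin m) → R)).symm.toLinearMap) :=
    hf.comp (LinearEquiv.surjective _)
  have hS := LinearMap.shortExact_shortComplexKer hf'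
  -- `Ext^{n+1}(M, L)` is a quotient of `Ext^{n+1}(M, F)` for a finite free cover `F` of `L`,
  -- because `Ext^{n+2}(M, -)` vanishes.
  obtain ⟨y, rfl⟩ := Ext.covariant_sequence_exact₃ M hS x (n₁ := n + 2) rfl
    (Ext.eq_zero_of_hasProjectiveDimensionLT _ (n + 2) le_rfl)
  rw [ext_projective_eq_zero h _ y, Ext.zero_comp]

/-- Every morphism from a module to a finitely generated module becomes surjective after adding a
finitely generated free module to its source. -/
lemma exists_shortExact_biprod [IsNoetherianRing R] {M T : ModuleCat.{u} R} [Module.Finite R M]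
    [Module.Finite R T] (g : M ⟶ T) :
    ∃ (F K : ModuleCat.{u} R) (π : F ⟶ T) (ι : K ⟶ M ⊞ F) (w : ι ≫ biprod.desc g π = 0),
      (ShortComplex.mk ι (biprod.desc g π) w).ShortExact ∧ Module.Finite R F ∧ Module.Free R F ∧
        Module.Finite R K := by
  obtain ⟨F, _, _, _, _, π, hπ⟩ := Module.exists_finite_presentation R T
  have : Epi (ModuleCat.ofHom π) := (ModuleCat.epi_iff_surjective _).2 hπ
  have hepi : Epi (biprod.desc g (ModuleCat.ofHom π)) :=
    epi_of_epi_fac (biprod.inr_desc g (ModuleCat.ofHom π))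
  have : Module.Finite R (M × F) := inferInstance
  have h2 : Module.Finite R (M ⊞ ModuleCat.of R F : ModuleCat.{u} R) :=
    Module.Finite.equiv (ModuleCat.biprodIsoProd M (ModuleCat.of R F)).symm.toLinearEquiv
  refine ⟨ModuleCat.of R F, kernel (biprod.desc g (ModuleCat.ofHom π)), ModuleCat.ofHom π,
    kernel.ι _, kernel.condition _,
    { exact := ShortComplex.exact_of_f_is_kernel _ (kernelIsKernel _) }, ‹_›, ‹_›, ?_⟩
  exact Module.Finite.of_injective (kernel.ι (biprod.desc g (ModuleCat.ofHom π))).hom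
    ((ModuleCat.mono_iff_injective _).1 inferInstance)

end ExtBasics


/-! ### Local freeness on the punctured spectrum via annihilation of `Ext` -/

section PuncturedSpectrum

variable {R : Type u} [CommRing R]

lemma smul_ext_eq_zero_of_factor {M F : ModuleCat.{u} R} [Projective F] {r : R} (f : M ⟶ F)
    (g : F ⟶ M) (h : f ≫ g = r • 𝟙 M) {i : ℕ} {N : ModuleCat.{u} R} (y : Ext M N (i + 1)) :
    r • y = 0 := by
  rw [← y.mk₀_id_comp, ← Ext.smul_comp, ← Ext.mk₀_smul, ← h, ← Ext.mk₀_comp_mk₀_assoc,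
    Ext.eq_zero_of_projective ((Ext.mk₀ g).comp y _), Ext.comp_zero]

/-- If multiplication by a power of `x` on the first term of a short exact sequence extends to the
middle term, then multiplication by this power on the third term factors through the middle
term. -/
lemma exists_factor_X₃ {S : ShortComplex (ModuleCat.{u} R)} (hS : S.ShortExact) {r : R}
    (p : S.X₂ ⟶ S.X₁) (hp : S.f ≫ p = r • 𝟙 S.X₁) :
    ∃ f : S.X₃ ⟶ S.X₂, f ≫ S.g = r • 𝟙 S.X₃ := by
  have := hS.epi_g
  have hz : S.f ≫ (r • 𝟙 S.X₂ - p ≫ S.f) = 0 := by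
    rw [Preadditive.comp_sub, ← Category.assoc, hp]
    simp
  refine ⟨hS.exact.desc _ hz, ?_⟩
  rw [← cancel_epi S.g, hS.exact.g_desc_assoc]
  simp

variable [IsLocalRing R]

/-- The modules `M` such that every element of the maximal ideal has a power annihilating all the
`Ext^{i+1}(M, N)`. -/
def ExtPowerTorsion (M : ModuleCat.{u} R) : Prop :=
  ∀ x ∈ maximalIdeal R, ∃ n : ℕ, ∀ (i : ℕ) (N : ModuleCat.{u} R) (y : Ext M N (i + 1)),
    x ^ n • y = 0

lemma extPowerTorsion_of_factor {M : ModuleCat.{u} R}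
    (h : ∀ x ∈ maximalIdeal R, ∃ (n : ℕ) (F : ModuleCat.{u} R) (_ : Projective F) (f : M ⟶ F)
      (g : F ⟶ M), f ≫ g = x ^ n • 𝟙 M) : ExtPowerTorsion M := by
  intro x hx
  obtain ⟨n, F, _, f, g, hfg⟩ := h x hx
  exact ⟨n, fun i N y ↦ smul_ext_eq_zero_of_factor f g hfg y⟩

/-- The obstruction to lifting `e` along `S.g` is a class in `Ext^1(M, S.X₁)`, which a power of `x`
kills. -/
lemma ExtPowerTorsion.exists_section {M : ModuleCat.{u} R} (h : ExtPowerTorsion M)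
    {S : ShortComplex (ModuleCat.{u} R)} (hS : S.ShortExact) (e : M ⟶ S.X₃) {x : R}
    (hx : x ∈ maximalIdeal R) : ∃ (n : ℕ) (f : M ⟶ S.X₂), f ≫ S.g = x ^ n • e := by
  obtain ⟨n, hn⟩ := h x hx
  obtain ⟨y, hy⟩ := Ext.covariant_sequence_exact₃ M hS (x ^ n • Ext.mk₀ e) (zero_add 1)
    (by rw [Ext.smul_comp, hn])
  obtain ⟨f, rfl⟩ := (Ext.mk₀_bijective _ _).2 y
  refine ⟨n, f, (Ext.mk₀_bijective _ _).1 ?_⟩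
  rw [← Ext.mk₀_comp_mk₀, hy, Ext.mk₀_smul]

lemma extPowerTorsion_of_projective (M : ModuleCat.{u} R) [Projective M] : ExtPowerTorsion M :=
  fun _ _ ↦ ⟨0, fun _ _ y ↦ by rw [Ext.eq_zero_of_projective y, smul_zero]⟩

lemma ExtPowerTorsion.of_retract {M N : ModuleCat.{u} R} (r : Retract M N)
    (h : ExtPowerTorsion N) : ExtPowerTorsion M := by
  intro x hx
  obtain ⟨n, hn⟩ := h x hx
  refine ⟨n, fun i L y ↦ ?_⟩
  rw [← y.mk₀_id_comp, ← r.retract, ← Ext.mk₀_comp_mk₀_assoc, ← Ext.comp_smul, hn, Ext.comp_zero]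

lemma ExtPowerTorsion.X₂ {S : ShortComplex (ModuleCat.{u} R)} (hS : S.ShortExact)
    (h₁ : ExtPowerTorsion S.X₁) (h₃ : ExtPowerTorsion S.X₃) : ExtPowerTorsion S.X₂ := by
  intro x hx
  obtain ⟨n, hn⟩ := h₁ x hx
  obtain ⟨m, hm⟩ := h₃ x hx
  refine ⟨m + n, fun i L y ↦ ?_⟩
  obtain ⟨z, hz⟩ := Ext.contravariant_sequence_exact₂ hS L (x ^ n • y)
    (by rw [Ext.comp_smul, hn])
  rw [pow_add, mul_smul, ← hz, ← Ext.comp_smul, hm, Ext.comp_zero]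

lemma ExtPowerTorsion.X₁ {S : ShortComplex (ModuleCat.{u} R)} (hS : S.ShortExact)
    (h₂ : ExtPowerTorsion S.X₂) (h₃ : ExtPowerTorsion S.X₃) : ExtPowerTorsion S.X₁ := by
  intro x hx
  obtain ⟨n, hn⟩ := h₂ x hx
  obtain ⟨m, hm⟩ := h₃ x hx
  refine ⟨n + m, fun i L y ↦ ?_⟩
  obtain ⟨z, hz⟩ := Ext.contravariant_sequence_exact₁ hS L (x ^ m • y) (n₁ := i + 1 + 1)
    (by omega) (by rw [Ext.comp_smul, hm])
  rw [pow_add, mul_smul, ← hz, ← Ext.comp_smul, hn, Ext.comp_zero]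

/-- For `p ≠ 𝔪` choose `x ∈ 𝔪` outside `p`. Some `x ^ n • 𝟙 M` factors through a free cover, and `x
^ n` is invertible at `p`, so the localized cover splits. -/
lemma locFreePunctured_of_extPowerTorsion {M : ModuleCat.{u} R} [Module.Finite R M]
    (h : ExtPowerTorsion M) : LocFreePunctured M := by
  intro p hp
  have hne : p.asIdeal ≠ maximalIdeal R := fun he ↦ hp (PrimeSpectrum.ext he)
  obtain ⟨x, hx, hxp⟩ : ∃ x ∈ maximalIdeal R, x ∉ p.asIdeal := by
    by_contra! hc
    exact hne (le_antisymm (le_maximalIdeal p.isPrime.ne_top) hc)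
  obtain ⟨F, _, _, _, _, π, hπ⟩ := Module.exists_finite_presentation R M
  obtain ⟨n, f, hf⟩ := h.exists_section (LinearMap.shortExact_shortComplexKer hπ) (𝟙 M) hx
  have hf' : π ∘ₗ f.hom = x ^ n • LinearMap.id := congr(($hf).hom)
  rw [Module.mem_freeLocus]
  let A := Localization.AtPrime p.asIdeal
  let S := p.asIdeal.primeCompl
  let f' := LocalizedModule.map S f.hom
  let π' := LocalizedModule.map S π
  have hx' : IsUnit (algebraMap R A (x ^ n)) :=
    IsLocalization.map_units A (⟨x ^ n, S.pow_mem hxp n⟩ : S)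
  obtain ⟨c, hc⟩ := hx'
  have hcomp : π' ∘ₗ f' = (c : A) • LinearMap.id := by
    apply LinearMap.ext
    intro z
    induction z using LocalizedModule.induction_on with
    | h m s =>
      have : π (f.hom m) = x ^ n • m := by simpa using congr($hf' m)
      simp only [f', π', LinearMap.comp_apply, LocalizedModule.map_mk, this, LinearMap.smul_apply,
        LinearMap.id_apply, hc]
      rw [algebraMap_smul, LocalizedModule.smul'_mk]
  have hproj : Module.Projective (Localization.AtPrime p.asIdeal)
      (LocalizedModule p.asIdeal.primeCompl M) := by
    refine Module.Projective.of_split f' ((c⁻¹ : Aˣ) • π') ?_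
    rw [Units.smul_def, LinearMap.smul_comp, hcomp, smul_smul]
    simp
  have hflat : Module.Flat (Localization.AtPrime p.asIdeal)
      (LocalizedModule p.asIdeal.primeCompl M) := @Module.Flat.of_projective _ _ _ _ _ hproj
  exact Module.free_of_flat_of_isLocalRing

/-- For `x ∈ 𝔪` the open set `D(x)` misses the closed point, so `M_x` is projective and its free
cover splits. Clearing denominators factors a power of `x` through a free module. -/
lemma extPowerTorsion_of_locFreePunctured [IsNoetherianRing R] {M : ModuleCat.{u} R}
    [Module.Finite R M] (h : LocFreePunctured M) : ExtPowerTorsion M := by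
  refine extPowerTorsion_of_factor fun x hx ↦ ?_
  have : Module.FinitePresentation R M := Module.finitePresentation_of_finite R M
  have hsub : (PrimeSpectrum.basicOpen x : Set (PrimeSpectrum R)) ⊆ Module.freeLocus R M := by
    intro p hp
    refine h p fun he ↦ hp ?_
    rw [he]
    exact hx
  rw [Module.basicOpen_subset_freeLocus_iff] at hsub
  obtain ⟨F, _, _, _, _, π, hπ⟩ := Module.exists_finite_presentation R M
  let S := Submonoid.powers x
  let A := Localization S
  have hπ' : Function.Surjective (LocalizedModule.map S π) :=
    LocalizedModule.map_surjective _ _ hπ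
  obtain ⟨s, hs⟩ := Module.projective_lifting_property (LocalizedModule.map S π) LinearMap.id hπ'
  obtain ⟨f, c, hf⟩ := Module.FinitePresentation.exists_lift_of_isLocalizedModule S
    (LocalizedModule.mkLinearMap S F) ((s.restrictScalars R) ∘ₗ LocalizedModule.mkLinearMap S M)
  obtain ⟨_, n, rfl⟩ := c
  have heq : LocalizedModule.mkLinearMap S M ∘ₗ (π ∘ₗ f) =
      LocalizedModule.mkLinearMap S M ∘ₗ (x ^ n • LinearMap.id) := by
    apply LinearMap.ext
    intro m
    have h1 := congr($hf m)
    have h2 := congr($hs (LocalizedModule.mkLinearMap S M m))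
    have h3 : LocalizedModule.mkLinearMap S M (π (f m)) =
        LocalizedModule.map S π (LocalizedModule.mkLinearMap S F (f m)) := by
      simp [LocalizedModule.map_mk]
    simp only [LinearMap.comp_apply] at h1 h2 ⊢
    rw [h3, h1]
    simp only [Submonoid.smul_def, LinearMap.smul_apply, LinearMap.comp_apply,
      LinearMap.coe_restrictScalars, LinearMap.id_apply, map_smul]
    rw [LinearMap.map_smul_of_tower, h2]
    rfl
  -- The factorization holds only after inverting `x`; a further power `x ^ l` makes it hold in `M`.
  obtain ⟨⟨_, l, rfl⟩, hl⟩ := Module.Finite.exists_smul_of_comp_eq_of_isLocalizedModule S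
    (LocalizedModule.mkLinearMap S M) _ _ heq
  refine ⟨l + n, ModuleCat.of R F, inferInstance, ModuleCat.ofHom (x ^ l • f),
    ModuleCat.ofHom π, ?_⟩
  ext m
  have := congr($hl m)
  simp only [LinearMap.smul_apply, LinearMap.comp_apply, LinearMap.id_apply] at this
  simp only [ModuleCat.hom_comp, ModuleCat.hom_ofHom, LinearMap.comp_apply, LinearMap.smul_apply,
    map_smul, pow_add, mul_smul, ModuleCat.hom_smul, ModuleCat.hom_id, LinearMap.id_apply]
  exact this

end PuncturedSpectrum


/-! ### Minimal free covers over a local ring -/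

section MinimalCover

variable {R : Type u} [CommRing R]

lemma finite_generators (M : ModuleCat.{u} R) [Module.Finite R M] :
    Finite (⊤ : Submodule R M).generators :=
  (Submodule.FG.finite_generators Module.Finite.fg_top).to_subtype

lemma minCover_surjective (M : ModuleCat.{u} R) : Function.Surjective (minCover M) := by
  rw [← LinearMap.range_eq_top, minCover, Finsupp.range_linearCombination, Subtype.range_coe,
    Submodule.span_generators]

lemma finsupp_mem_smul_top {ι : Type*} (I : Ideal R) (v : ι →₀ R) (h : ∀ i, v i ∈ I) :
    v ∈ I • (⊤ : Submodule R (ι →₀ R)) := by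
  rw [← v.sum_single]
  refine Submodule.sum_mem _ fun i _ ↦ ?_
  have : Finsupp.single i (v i) = v i • Finsupp.single i (1 : R) := by simp
  rw [this]
  exact Submodule.smul_mem_smul (h i) trivial

open Classical in
-- A relation with a unit coefficient would make one generator redundant, against minimal
-- cardinality.
lemma ker_minCover_le [IsLocalRing R] (M : ModuleCat.{u} R) [Module.Finite R M] :
    LinearMap.ker (minCover M) ≤ maximalIdeal R • (⊤ : Submodule R (MinCover M)) := by
  intro v hv
  refine finsupp_mem_smul_top _ v fun a ↦ ?_
  by_contra ha
  rw [mem_maximalIdeal, mem_nonunits_iff, not_not] at ha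
  have hfg : (⊤ : Submodule R M).FG := Module.Finite.fg_top
  have hfin := hfg.finite_generators
  let G := (⊤ : Submodule R M).generators
  have hsum : minCover M (v.erase a) + v a • (a : M) = 0 := by
    rw [LinearMap.mem_ker] at hv
    conv_rhs => rw [← hv, ← Finsupp.erase_add_single a v]
    simp [minCover]
  have hmem : minCover M (v.erase a) ∈ Submodule.span R (G \ {(a : M)}) := by
    rw [minCover, Finsupp.linearCombination_apply]
    refine Submodule.sum_mem _ fun b hb ↦ Submodule.smul_mem _ _ (Submodule.subset_span ⟨b.2, ?_⟩)
    rw [Finsupp.support_erase, Finset.mem_erase] at hb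
    exact fun h ↦ hb.1 (Subtype.ext h)
  have ha' : (a : M) ∈ Submodule.span R (G \ {(a : M)}) := by
    rw [← Submodule.smul_mem_iff_of_isUnit _ ha, eq_neg_of_add_eq_zero_right hsum]
    exact Submodule.neg_mem _ hmem
  have htop : Submodule.span R (G \ {(a : M)}) = ⊤ := by
    refine eq_top_iff.2 ((Submodule.span_generators (⊤ : Submodule R M)).ge.trans ?_)
    rw [Submodule.span_le]
    intro b hb
    by_cases hba : b = a
    · rw [hba]; exact ha'
    · exact Submodule.subset_span ⟨hb, hba⟩
  have h1 := Submodule.spanFinrank_span_le_ncard_of_finite (R := R) (hfin.sdiff (t := {(a : M)}))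
  rw [htop, ← hfg.generators_ncard] at h1
  have h2 := Set.ncard_sdiff_singleton_lt_of_mem a.2 hfin
  omega

open Classical in
/-- A morphism from a projective module with image in `I • F` is an `I`-linear combination of
morphisms. -/
lemma exists_eq_sum_smul {N F : ModuleCat.{u} R} [Module.Projective R N] (f : N ⟶ F)
    {I : Ideal R} (hI : I.FG) (hf : LinearMap.range f.hom ≤ I • (⊤ : Submodule R F)) :
    ∃ (s : Finset R) (g : s → (N ⟶ F)), (∀ x ∈ s, x ∈ I) ∧ f = ∑ x : s, (x : R) • g x := by
  obtain ⟨s, rfl⟩ := hI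
  let T : (s → F) →ₗ[R] F := ∑ x : s, (x : R) • LinearMap.proj x
  have hT : Ideal.span (s : Set R) • (⊤ : Submodule R F) ≤ LinearMap.range T := by
    rw [Submodule.smul_le]
    intro r hr n _
    have : Ideal.span (s : Set R) ≤
        (LinearMap.range T).comap (LinearMap.toSpanSingleton R F n) := by
      rw [Ideal.span, Submodule.span_le]
      intro x hx
      refine ⟨Pi.single ⟨x, hx⟩ n, ?_⟩
      simp only [T, LinearMap.sum_apply, LinearMap.smul_apply, LinearMap.proj_apply,
        LinearMap.toSpanSingleton_apply]
      rw [Finset.sum_eq_single ⟨x, hx⟩, Pi.single_eq_same]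
      · intro b _ hb
        rw [Pi.single_eq_of_ne hb, smul_zero]
      · exact fun h ↦ absurd (Finset.mem_univ _) h
    exact this hr
  obtain ⟨g, hg⟩ := Module.projective_lifting_property T.rangeRestrict
    (f.hom.codRestrict (LinearMap.range T) fun n ↦ hT (hf ⟨n, rfl⟩)) T.surjective_rangeRestrict
  refine ⟨s, fun x ↦ ModuleCat.ofHom (LinearMap.proj x ∘ₗ g), fun x hx ↦ Ideal.subset_span hx, ?_⟩
  ext n
  have : T (g n) = f.hom n := congr(($hg n : F))
  rw [← this]
  simp [T, ModuleCat.hom_sum]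

/-- The ring is a retract of each nonzero finitely generated projective module over a local
ring. -/
lemma exists_split_of_projective [IsLocalRing R] (M : ModuleCat.{u} R) [Module.Finite R M]
    [Module.Projective R M] [Nontrivial M] :
    ∃ (f : ModuleCat.of R R ⟶ M) (g : M ⟶ ModuleCat.of R R), f ≫ g = 𝟙 _ := by
  have : Module.Free R M := Module.free_of_flat_of_isLocalRing
  let b := Module.Free.chooseBasis R M
  obtain ⟨i⟩ := b.index_nonempty
  refine ⟨ModuleCat.ofHom (LinearMap.toSpanSingleton R M (b i)), ModuleCat.ofHom (b.coord i), ?_⟩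
  ext
  simp

end MinimalCover

/-! ### Depth and the Auslander–Buchsbaum inequality -/

section Depth

variable {R : Type u} [CommRing R] [IsLocalRing R]

lemma smul_ext_resField_eq_zero {M : ModuleCat.{u} R} {i : ℕ} {r : R} (hr : r ∈ maximalIdeal R)
    (x : Ext (resField R) M i) : r • x = 0 := by
  have h : r • 𝟙 (resField R) = 0 := by
    ext
    simp only [ModuleCat.hom_smul, LinearMap.smul_apply, ModuleCat.hom_id, LinearMap.id_apply]
    rw [Algebra.smul_def, ResidueField.algebraMap_eq, (residue_eq_zero_iff r).2 hr, zero_mul]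
    rfl
  rw [← x.mk₀_id_comp, ← Ext.smul_comp, ← Ext.mk₀_smul, h]
  simp

/-- Rees' argument: `r ∈ 𝔪` acts as zero on `Ext(k, -)`, so the long exact sequence of `0 → M → M →
M/rM → 0` breaks into short ones, and each element of the sequence shifts degrees by one. -/
lemma ext_resField_of_isWeaklyRegular (rs : List R) (hm : ∀ r ∈ rs, r ∈ maximalIdeal R)
    (M : ModuleCat.{u} R) (h : RingTheory.Sequence.IsWeaklyRegular M rs) :
    (∀ i < rs.length, ∀ x : Ext (resField R) M i, x = 0) ∧
      ((∀ x : Ext (resField R) M rs.length, x = 0) →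
        Subsingleton (ResidueField R →ₗ[R] M ⧸ Ideal.ofList rs • (⊤ : Submodule R M))) := by
  induction rs generalizing M with
  | nil =>
    refine ⟨fun i hi ↦ by simp at hi, fun h0 ↦ ?_⟩
    rw [Ideal.ofList_nil, Submodule.bot_smul]
    let e := (Submodule.quotEquivOfEqBot (⊥ : Submodule R M) rfl)
    refine subsingleton_of_forall_eq 0 fun f ↦ ?_
    have := h0 (Ext.mk₀ (ModuleCat.ofHom (e.toLinearMap ∘ₗ f)))
    rw [Ext.mk₀_eq_zero_iff] at this
    ext z
    exact e.injective (by simpa using congr(($this).hom z))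
  | cons r rs ih =>
    rw [RingTheory.Sequence.isWeaklyRegular_cons_iff] at h
    obtain ⟨ih1, ih2⟩ := ih (fun a ha ↦ hm a (by simp [ha])) (ModuleCat.of R (QuotSMulTop r M)) h.2
    have hS := h.1.smulShortComplex_shortExact
    have hf : ∀ {i : ℕ} (x : Ext (resField R) M i),
        x.comp (Ext.mk₀ (M.smulShortComplex r).f) (add_zero i) = 0 := by
      intro i x
      exact (Ext.smul_eq_comp_mk₀ x r).symm.trans (smul_ext_resField_eq_zero (hm r (by simp)) x)
    have ih1' : ∀ i < rs.length, ∀ x : Ext (resField R) (M.smulShortComplex r).X₃ i, x = 0 := ih1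
    have hvan : ∀ i < (r :: rs).length, ∀ x : Ext (resField R) M i, x = 0 := by
      intro i hi x
      cases i with
      | zero =>
        have := hS.mono_f
        exact Ext.postcomp_mk₀_injective_of_mono _ (M.smulShortComplex r).f
          ((hf x).trans (map_zero _).symm)
      | succ i =>
        obtain ⟨y, rfl⟩ := Ext.covariant_sequence_exact₁ _ hS x (hf x) rfl
        rw [ih1' i (by simpa using hi) y]
        exact Ext.zero_comp _ _ _ _ _
    refine ⟨hvan, fun h0 ↦ ?_⟩
    have hvan' : ∀ y : Ext (resField R) (M.smulShortComplex r).X₂ rs.length, y = 0 :=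
      hvan rs.length (by simp)
    have h0' : ∀ y : Ext (resField R) (M.smulShortComplex r).X₁ (rs.length + 1), y = 0 := h0
    have := ih2 fun x ↦ by
      obtain ⟨y, hy⟩ := Ext.covariant_sequence_exact₃ _ hS x (n₁ := rs.length + 1) rfl (h0' _)
      rw [hvan' y] at hy
      exact by simpa using! hy.symm
    exact ((Submodule.quotOfListConsSMulTopEquivQuotSMulTopInner M r rs).congrRight
      (M := ResidueField R)).toEquiv.subsingleton_congr.2 this

/-- Take a regular sequence of length `t`. If `Ext^t(k, R)` vanished, there would be no nonzero map
from `k` to `R/(rs)`, so some element of `𝔪` would be regular on that quotient and lengthen the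
sequence. -/
lemma ext_resField_of_ringDepth [IsNoetherianRing R] {t : ℕ} (ht : ringDepth R = t) :
    (∀ i < t, ∀ x : Ext (resField R) (ModuleCat.of R R) i, x = 0) ∧
      ∃ x : Ext (resField R) (ModuleCat.of R R) t, x ≠ 0 := by
  obtain ⟨rs, hreg, hm, hlen⟩ : (t : ℕ∞) ∈ {d : ℕ∞ | ∃ rs : List R,
      RingTheory.Sequence.IsRegular R rs ∧ (∀ r ∈ rs, r ∈ maximalIdeal R) ∧ d = rs.length} := by
    rw [← ht]
    have : Nonempty {d : ℕ∞ | ∃ rs : List R, RingTheory.Sequence.IsRegular R rs ∧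
        (∀ r ∈ rs, r ∈ maximalIdeal R) ∧ d = rs.length} := ⟨0, [], .nil _ _, by simp, by simp⟩
    exact ENat.sSup_mem_of_nonempty_of_lt_top (ht.trans_lt (ENat.natCast_lt_top t))
  obtain rfl : t = rs.length := by exact_mod_cast hlen
  obtain ⟨h1, h2⟩ := ext_resField_of_isWeaklyRegular rs hm (ModuleCat.of R R) hreg.1
  refine ⟨h1, ?_⟩
  by_contra! h0
  have hsub := h2 h0
  obtain ⟨r, hr, hreg'⟩ := IsSMulRegular.subsingleton_linearMap_iff.1 hsub
  have hrm : r ∈ maximalIdeal R := by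
    have := Ideal.annihilator_quotient (I := maximalIdeal R)
    rwa [← this]
  have hall : ∀ a ∈ rs ++ [r], a ∈ maximalIdeal R := by
    intro a ha
    rcases List.mem_append.1 ha with ha | ha
    · exact hm a ha
    · rw [List.mem_singleton.1 ha]; exact hrm
  have hreg'' : RingTheory.Sequence.IsRegular R (rs ++ [r]) := by
    rw [isRegular_iff_isWeaklyRegular_of_subset_maximalIdeal hall,
      RingTheory.Sequence.isWeaklyRegular_append_iff,
      RingTheory.Sequence.isWeaklyRegular_singleton_iff]
    exact ⟨hreg.1, hreg'⟩
  have : ((rs ++ [r]).length : ℕ∞) ≤ ringDepth R := le_sSup ⟨_, hreg'', hall, rfl⟩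
  rw [ht] at this
  have := ENat.natCast_le_natCast.1 this
  simp at this

/-- The Auslander–Buchsbaum inequality, with the nonvanishing of `Ext` expressing the
Auslander–Buchsbaum formula. -/
lemma le_depth_of_projectiveDimension [IsNoetherianRing R] {t : ℕ} (ht : ringDepth R = t) (s : ℕ)
    (M : ModuleCat.{u} R) [Module.Finite R M] (h : HasProjectiveDimensionLE M s)
    (h' : ¬ HasProjectiveDimensionLT M s) : s ≤ t ∧ ∃ x : Ext (resField R) M (t - s), x ≠ 0 := by
  obtain ⟨hvan, x₀, hx₀⟩ := ext_resField_of_ringDepth ht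
  induction s generalizing M with
  | zero =>
    have : Projective M := projective_iff_hasProjectiveDimensionLE_zero M |>.2 h
    have : Module.Projective R M := (IsProjective.iff_projective M).2 this
    have : Nontrivial M := by
      rw [← not_subsingleton_iff_nontrivial, ← ModuleCat.isZero_iff_subsingleton]
      exact fun hz ↦ h' hz.hasProjectiveDimensionLT_zero
    obtain ⟨f, g, hfg⟩ := exists_split_of_projective M
    refine ⟨Nat.zero_le t, x₀.comp (Ext.mk₀ f) (add_zero t), fun h0 ↦ hx₀ ?_⟩
    rw [← x₀.comp_mk₀_id, ← hfg, ← Ext.mk₀_comp_mk₀, ← Ext.comp_assoc_of_third_deg_zero, h0,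
      Ext.zero_comp]
  | succ s ih =>
    have hS := LinearMap.shortExact_shortComplexKer (minCover_surjective M)
    have := finite_generators M
    have hN := hS.hasProjectiveDimensionLT_X₁ (s + 1) inferInstance h
    obtain ⟨hs, x, hx⟩ := ih (ModuleCat.of R (LinearMap.ker (minCover M))) hN fun hN' ↦
      h' (hS.hasProjectiveDimensionLT_X₃ s hN' inferInstance)
    -- For `s = 0` the syzygy is projective with image in `𝔪F`, so the inclusion is an
    -- `𝔪`-combination of maps, and `𝔪` kills `Ext(k, -)`. For `s > 0` the target `Ext^{t-s}(k, F)`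
    -- vanishes.
    have hzero : x.comp (Ext.mk₀ (minCover M).shortComplexKer.f) (add_zero (t - s)) = 0 := by
      rcases Nat.eq_zero_or_pos s with rfl | hs'
      · have : Projective (ModuleCat.of R (LinearMap.ker (minCover M))) :=
          (projective_iff_hasProjectiveDimensionLE_zero _).2 hN
        have : Module.Projective R (LinearMap.ker (minCover M)) :=
          (IsProjective.iff_projective _).2 this
        obtain ⟨S, g, hSm, hg⟩ := exists_eq_sum_smul
          (N := ModuleCat.of R (LinearMap.ker (minCover M))) (minCover M).shortComplexKer.f
          (IsNoetherian.noetherian (maximalIdeal R)) (by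
            simpa using ker_minCover_le M)
        rw [hg, Ext.mk₀_sum, Ext.comp_sum]
        refine Finset.sum_eq_zero fun i _ ↦ ?_
        rw [Ext.mk₀_smul, Ext.comp_smul]
        exact smul_ext_resField_eq_zero (hSm i i.2) _
      · exact ext_projective_eq_zero (hvan (t - s) (by omega)) (ModuleCat.of R (MinCover M)) _
    -- If `t = s` the map on `Hom(k, -)` is both injective and zero on `x ≠ 0`; so `s < t`, and `x`
    -- comes from `Ext^{t-s-1}(k, M)`.
    rcases Nat.eq_zero_or_pos (t - s) with h0 | h0
    · exfalso
      have := hS.mono_f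
      generalize t - s = a at *
      subst h0
      exact hx (Ext.postcomp_mk₀_injective_of_mono _ (minCover M).shortComplexKer.f
        (hzero.trans (map_zero _).symm))
    · obtain ⟨y, rfl⟩ := Ext.covariant_sequence_exact₁ _ hS x hzero (n₀ := t - (s + 1)) (by omega)
      exact ⟨by omega, y, fun h0 ↦ hx (by rw [h0, Ext.zero_comp])⟩

end Depth


/-! ### Transposes of consecutive syzygies -/

section Transpose

variable {R : Type u} [CommRing R] [IsNoetherianRing R]

instance finite_minCover (M : ModuleCat.{u} R) [Module.Finite R M] :
    Module.Finite R (MinCover M) := by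
  have := finite_generators M
  infer_instance

instance finite_syz (M : ModuleCat.{u} R) [Module.Finite R M] : Module.Finite R (syz M) :=
  inferInstanceAs (Module.Finite R (LinearMap.ker (minCover M)))

instance finite_nsyz (M : ModuleCat.{u} R) [Module.Finite R M] (j : ℕ) :
    Module.Finite R (nsyz j M) := by
  induction j with
  | zero => exact ‹_›
  | succ j ih => exact finite_syz _

instance finite_transp (M : ModuleCat.{u} R) [Module.Finite R M] : Module.Finite R (transp M) :=
  inferInstanceAs (Module.Finite R
    (Module.Dual R (MinCover (syz M)) ⧸ LinearMap.range (minPres M).dualMap))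

/-- The inclusion of the syzygy into the minimal free cover. -/
noncomputable def syzIncl {R : Type u} [CommRing R] (M : ModuleCat.{u} R) :
    syz M →ₗ[R] MinCover M :=
  (LinearMap.ker (minCover M)).subtype

lemma minCover_syzIncl {R : Type u} [CommRing R] (M : ModuleCat.{u} R) (x : syz M) :
    minCover M (syzIncl M x) = 0 :=
  x.2

lemma syzIncl_injective {R : Type u} [CommRing R] (M : ModuleCat.{u} R) :
    Function.Injective (syzIncl M) :=
  Submodule.subtype_injective _

/-- The short exact sequence `0 → Ω M → F → M → 0` given by the minimal free cover of `M`. -/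
noncomputable abbrev syzSequence {R : Type u} [CommRing R] (M : ModuleCat.{u} R) :
    ShortComplex (ModuleCat.{u} R) :=
  ShortComplex.mk (X₁ := syz M) (X₂ := ModuleCat.of R (MinCover M)) (X₃ := M)
    (ModuleCat.ofHom (syzIncl M)) (ModuleCat.ofHom (minCover M))
    (ModuleCat.hom_ext (LinearMap.ext (minCover_syzIncl M)))

lemma shortExact_syz {R : Type u} [CommRing R] (M : ModuleCat.{u} R) :
    (syzSequence M).ShortExact :=
  LinearMap.shortExact_shortComplexKer (minCover_surjective M)

lemma ext_nsyz_eq_zero {R : Type u} [CommRing R] {M Y : ModuleCat.{u} R} (j : ℕ) {i m : ℕ}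
    (hm : m = j + i + 1) (h : ∀ x : Ext M Y m, x = 0) (x : Ext (nsyz j M) Y (i + 1)) : x = 0 := by
  induction j generalizing i with
  | zero =>
    obtain rfl : m = i + 1 := by omega
    exact h x
  | succ j ih =>
    exact (ext_X₃_eq_zero_iff (shortExact_syz (nsyz j M)) Y i).1
      (fun y ↦ ih (i := i + 1) (by omega) y) x

lemma minPres_apply {R : Type u} [CommRing R] (M : ModuleCat.{u} R) (v : MinCover (syz M)) :
    minPres M v = syzIncl M (minCover (syz M) v) := rfl

lemma exists_minPres_eq {R : Type u} [CommRing R] {M : ModuleCat.{u} R}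
    {v : MinCover M} (hv : minCover M v = 0) : ∃ w, minPres M w = v := by
  let x : syz M := ⟨v, hv⟩
  obtain ⟨w, hw⟩ := minCover_surjective (syz M) x
  refine ⟨w, ?_⟩
  rw [minPres_apply, hw]
  rfl

lemma minPres_minPres {R : Type u} [CommRing R] (M : ModuleCat.{u} R)
    (w : MinCover (syz (syz M))) : minPres M (minPres (syz M) w) = 0 := by
  rw [minPres_apply, minPres_apply (syz M), minCover_syzIncl, map_zero]

/-- The map `Tr M → F₂*` induced by the dual of the second map of a minimal free resolution. -/
noncomputable def transpMap {R : Type u} [CommRing R] (M : ModuleCat.{u} R) :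
    transp M ⟶ ModuleCat.of R (Module.Dual R (MinCover (syz (syz M)))) :=
  ModuleCat.ofHom (Submodule.liftQ _ (minPres (syz M)).dualMap (by
    rintro _ ⟨g, rfl⟩
    refine LinearMap.ext fun w ↦ ?_
    simp only [LinearMap.dualMap_apply, minPres_minPres, map_zero, LinearMap.zero_apply]))

/-- The canonical projection `F₁* → Tr M`. -/
noncomputable def transpProj {R : Type u} [CommRing R] (M : ModuleCat.{u} R) :
    ModuleCat.of R (Module.Dual R (MinCover (syz M))) ⟶ transp M :=
  ModuleCat.ofHom (LinearMap.range (minPres M).dualMap).mkQ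

lemma transpProj_surjective {R : Type u} [CommRing R] (M : ModuleCat.{u} R) :
    Function.Surjective (transpProj M).hom :=
  Submodule.mkQ_surjective _

lemma transpMap_transpProj {R : Type u} [CommRing R] (M : ModuleCat.{u} R)
    (f : Module.Dual R (MinCover (syz M))) :
    (transpMap M).hom ((transpProj M).hom f) = (minPres (syz M)).dualMap f := rfl

lemma transpProj_eq_zero_iff {R : Type u} [CommRing R] (M : ModuleCat.{u} R)
    (f : Module.Dual R (MinCover (syz M))) :
    (transpProj M).hom f = 0 ↔ ∃ g, (minPres M).dualMap g = f :=
  Submodule.Quotient.mk_eq_zero _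

lemma exact_transpMap {R : Type u} [CommRing R] (M : ModuleCat.{u} R) :
    Function.Exact (transpMap M).hom (transpProj (syz M)).hom := by
  intro f
  rw [transpProj_eq_zero_iff]
  constructor
  · rintro ⟨g, rfl⟩
    exact ⟨(transpProj M).hom g, rfl⟩
  · rintro ⟨x, rfl⟩
    obtain ⟨g, rfl⟩ := transpProj_surjective M x
    exact ⟨g, rfl⟩

/-- The kernel is `Ext^1(M, R)`: a functional on `F₁` vanishing on the image of `F₂` descends to `Ω
M`, and then extends to `F₀` when this `Ext` is zero. -/
lemma transpMap_injective {R : Type u} [CommRing R] (M : ModuleCat.{u} R)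
    (h : ∀ x : Ext M (ModuleCat.of R R) 1, x = 0) : Function.Injective (transpMap M).hom := by
  refine (injective_iff_map_eq_zero (transpMap M).hom).2 fun x hx ↦ ?_
  obtain ⟨f, rfl⟩ := transpProj_surjective M x
  rw [transpMap_transpProj] at hx
  have hk : LinearMap.ker (minCover (syz M)) ≤ LinearMap.ker f := by
    intro v hv
    obtain ⟨w, rfl⟩ := exists_minPres_eq hv
    exact congr($hx w)
  obtain ⟨f', hf'⟩ : ∃ f' : syz M →ₗ[R] R, f' ∘ₗ minCover (syz M) = f := by
    refine ⟨(Submodule.liftQ _ f hk) ∘ₗ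
      ((minCover (syz M)).quotKerEquivOfSurjective (minCover_surjective _)).symm.toLinearMap, ?_⟩
    refine LinearMap.ext fun v ↦ ?_
    have : ((minCover (syz M)).quotKerEquivOfSurjective (minCover_surjective _)).symm
        (minCover (syz M) v) = Submodule.Quotient.mk v := by
      rw [LinearEquiv.symm_apply_eq]
      rfl
    simp only [LinearMap.comp_apply, LinearEquiv.coe_coe, this]
    rfl
  obtain ⟨g, hg⟩ := (ext_one_eq_zero_iff (shortExact_syz M) _).1 h (ModuleCat.ofHom f')
  refine (transpProj_eq_zero_iff M f).2 ⟨g.hom, ?_⟩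
  rw [← hf']
  exact LinearMap.ext fun v ↦ congr(($hg).hom (minCover (syz M) v))

lemma shortExact_transp {R : Type u} [CommRing R] (M : ModuleCat.{u} R)
    (h : ∀ x : Ext M (ModuleCat.of R R) 1, x = 0) :
    ∃ w : transpMap M ≫ transpProj (syz M) = 0,
      (ShortComplex.mk (transpMap M) (transpProj (syz M)) w).ShortExact := by
  have hex := exact_transpMap M
  exact ⟨ModuleCat.hom_ext hex.linearMap_comp_eq_zero, ModuleCat.shortComplex_shortExact _ hex
    (transpMap_injective M h) (transpProj_surjective (syz M))⟩

/-- By reflexivity of `F₁`, a functional on `Tr M` is evaluation at an element of `ker (F₁ → F₀)`,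
which lifts to `F₂`. When `transpMap M` is injective this says `Ext^1(Tr Ω M, R) = 0`. -/
lemma transpMap_extend (M : ModuleCat.{u} R) [Module.Finite R M]
    (f : transp M ⟶ ModuleCat.of R R) :
    ∃ g : ModuleCat.of R (Module.Dual R (MinCover (syz (syz M)))) ⟶ ModuleCat.of R R,
      transpMap M ≫ g = f := by
  let φ : Module.Dual R (Module.Dual R (MinCover (syz M))) := f.hom ∘ₗ (transpProj M).hom
  obtain ⟨v, hv⟩ := (Module.evalEquiv R (MinCover (syz M))).surjective φ
  have hv' : ∀ g : Module.Dual R (MinCover (syz M)), φ g = g v := by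
    intro g
    rw [← hv]
    rfl
  have hd : minPres M v = 0 := by
    refine Finsupp.ext fun a ↦ ?_
    have h1 := hv' ((minPres M).dualMap (Finsupp.lapply a))
    have h2 : φ ((minPres M).dualMap (Finsupp.lapply a)) = 0 :=
      (congrArg f.hom ((transpProj_eq_zero_iff M _).2 ⟨_, rfl⟩)).trans (map_zero _)
    exact h1.symm.trans h2
  obtain ⟨w, rfl⟩ := exists_minPres_eq
    (syzIncl_injective M ((minPres_apply M v).symm.trans (hd.trans (map_zero _).symm)))
  refine ⟨ModuleCat.ofHom (Module.Dual.eval R _ w), ?_⟩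
  refine ModuleCat.hom_ext (LinearMap.ext fun x ↦ ?_)
  obtain ⟨g, rfl⟩ := transpProj_surjective M x
  exact (hv' g).symm

end Transpose

/-! ### The dualized resolution of the residue field -/

section ResidueField

variable {R : Type u} [CommRing R] [IsLocalRing R] [IsNoetherianRing R]

instance finite_resField {R : Type u} [CommRing R] [IsLocalRing R] : Module.Finite R (resField R) :=
  inferInstanceAs (Module.Finite R (R ⧸ maximalIdeal R))

/-- The modules `R, Tr k, Tr Ω k, Tr Ω² k, …`. -/
noncomputable def transpSeq (R : Type u) [CommRing R] [IsLocalRing R] : ℕ → ModuleCat.{u} R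
  | 0 => ModuleCat.of R R
  | j + 1 => transp (nsyz j (resField R))

instance finite_transpSeq (j : ℕ) : Module.Finite R (transpSeq R j) := by
  cases j with
  | zero => exact inferInstanceAs (Module.Finite R R)
  | succ j => exact finite_transp _

lemma transpSeq_succ_exact (j : ℕ)
    (h : ∀ x : Ext (resField R) (ModuleCat.of R R) (j + 1), x = 0) :
    ∃ (G : ModuleCat.{u} R) (ι : transpSeq R (j + 1) ⟶ G) (π : G ⟶ transpSeq R (j + 2))
      (w : ι ≫ π = 0), (ShortComplex.mk ι π w).ShortExact ∧ Module.Finite R G ∧ Module.Free R G ∧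
        ∀ f : transpSeq R (j + 1) ⟶ ModuleCat.of R R, ∃ g, ι ≫ g = f := by
  obtain ⟨w, hw⟩ := shortExact_transp (nsyz j (resField R))
    (ext_nsyz_eq_zero j (i := 0) (by omega) h)
  exact ⟨_, _, _, w, hw, inferInstance, inferInstance, transpMap_extend _⟩

lemma exists_minCover_resField_equiv {R : Type u} [CommRing R] [IsLocalRing R] :
    ∃ e : MinCover (resField R) ≃ₗ[R] R,
    ∀ v, minCover (resField R) v = 0 ↔ e v ∈ maximalIdeal R := by
  obtain ⟨a, ha⟩ : ∃ a, (⊤ : Submodule R (resField R)).generators = {a} := by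
    have hfg : (⊤ : Submodule R (resField R)).FG := Module.Finite.fg_top
    have h1 : (⊤ : Submodule R (resField R)).spanFinrank = 1 := by
      rw [Submodule.spanFinrank_eq_one_iff]
      refine ⟨⟨(1 : ResidueField R), ?_⟩, ?_⟩
      · refine (eq_top_iff.2 fun z _ ↦ ?_).symm
        obtain ⟨r, rfl⟩ := residue_surjective (R := R) z
        refine Submodule.mem_span_singleton.2 ⟨r, ?_⟩
        rw [Algebra.smul_def, mul_one]
        rfl
      · exact (bot_ne_top (α := Submodule R (ResidueField R))).symm
    simpa [← hfg.generators_ncard] using h1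
  have hmem : ∀ b : (⊤ : Submodule R (resField R)).generators, (b : resField R) = a :=
    fun b ↦ ha.le b.2
  let a' : (⊤ : Submodule R (resField R)).generators := ⟨a, ha.ge rfl⟩
  let _ : Unique (⊤ : Submodule R (resField R)).generators :=
    ⟨⟨a'⟩, fun b ↦ Subtype.ext (hmem b)⟩
  have ha0 : a ≠ 0 := by
    rintro rfl
    have := Submodule.span_generators (⊤ : Submodule R (resField R))
    rw [ha, Submodule.span_zero_singleton] at this
    exact bot_ne_top (α := Submodule R (ResidueField R)) this
  refine ⟨Finsupp.uniqueLinearEquiv R R a', fun v ↦ ?_⟩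
  have hv : minCover (resField R) v = v a' • a := by
    rw [minCover, Finsupp.linearCombination_unique]
    rfl
  have h2 : v a' • a = residue R (v a') * (show ResidueField R from a) := Algebra.smul_def _ _
  rw [hv, h2]
  refine (mul_eq_zero_iff_right ?_).trans (residue_eq_zero_iff _)
  exact ha0

/-- The generator of the image of `F₀* → F₁*`, for the minimal free presentation of the residue
field. -/
lemma exists_dual_generator {R : Type u} [CommRing R] [IsLocalRing R] :
    ∃ lam : Module.Dual R (MinCover (syz (resField R))),
    LinearMap.range lam = maximalIdeal R ∧
      ∀ f, (∃ g, (minPres (resField R)).dualMap g = f) ↔ ∃ r : R, r • lam = f := by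
  obtain ⟨e, he⟩ := exists_minCover_resField_equiv (R := R)
  refine ⟨e.toLinearMap ∘ₗ minPres (resField R), le_antisymm ?_ fun x hx ↦ ?_, fun f ↦ ⟨?_, ?_⟩⟩
  · rintro _ ⟨v, rfl⟩
    exact (he _).1 (minCover_syzIncl _ _)
  · obtain ⟨v, hv⟩ := exists_minPres_eq (M := resField R) (v := e.symm x) ((he _).2 (by simpa))
    exact ⟨v, by simp [hv]⟩
  · rintro ⟨g, rfl⟩
    refine ⟨g (e.symm 1), LinearMap.ext fun v ↦ ?_⟩
    have : minPres (resField R) v = e (minPres (resField R) v) • e.symm 1 := by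
      rw [← map_smul, smul_eq_mul, mul_one, e.symm_apply_apply]
    simp only [LinearMap.smul_apply, LinearMap.comp_apply, LinearEquiv.coe_coe,
      LinearMap.dualMap_apply]
    conv_rhs => rw [this, map_smul]
    exact mul_comm _ _
  · rintro ⟨r, rfl⟩
    exact ⟨r • e.toLinearMap, rfl⟩

/-- Here `R` plays the role of `F₀*`. An element of the kernel of `R → F₁*` is killed by `𝔪`, hence
defines a map `k → R`, which is zero. The image of `1` has coordinates generating `𝔪`, which gives
the last two clauses. -/
lemma transpSeq_zero_exact (h : ∀ x : Ext (resField R) (ModuleCat.of R R) 0, x = 0) :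
    ∃ (G : ModuleCat.{u} R) (ι : ModuleCat.of R R ⟶ G) (π : G ⟶ transpSeq R 1)
      (w : ι ≫ π = 0), (ShortComplex.mk ι π w).ShortExact ∧ Module.Finite R G ∧ Module.Free R G ∧
        ι.hom (1 : R) ∈ maximalIdeal R • (⊤ : Submodule R G) ∧
        ∀ x ∈ maximalIdeal R, ∃ g : G →ₗ[R] R, g (ι.hom (1 : R)) = x := by
  obtain ⟨lam, hlam, hrange⟩ := exists_dual_generator (R := R)
  let ι : R →ₗ[R] Module.Dual R (MinCover (syz (resField R))) := LinearMap.toSpanSingleton R _ lam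
  have h1 : ι (1 : R) = lam := one_smul R lam
  have hex : Function.Exact ι (transpProj (resField R)).hom := fun f ↦
    (transpProj_eq_zero_iff _ _).trans (hrange f)
  have hinj : Function.Injective ι := by
    refine (injective_iff_map_eq_zero ι).2 fun r hr ↦ ?_
    have hann : maximalIdeal R ≤ LinearMap.ker (LinearMap.toSpanSingleton R R r) := by
      rw [← hlam]
      rintro _ ⟨v, rfl⟩
      have : r * lam v = 0 := congr($hr v)
      rw [LinearMap.mem_ker, LinearMap.toSpanSingleton_apply, smul_eq_mul, mul_comm, this]
    let f : resField R →ₗ[R] R :=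
      Submodule.liftQ (maximalIdeal R) (LinearMap.toSpanSingleton R R r) hann
    have hf := h (Ext.mk₀ (ModuleCat.ofHom f))
    rw [Ext.mk₀_eq_zero_iff] at hf
    have h2 : (1 : R) • r = 0 :=
      congr(($hf).hom (Submodule.Quotient.mk (1 : R) : R ⧸ maximalIdeal R))
    rwa [one_smul] at h2
  refine ⟨ModuleCat.of R (Module.Dual R (MinCover (syz (resField R)))), ModuleCat.ofHom ι,
    transpProj (resField R), ModuleCat.hom_ext hex.linearMap_comp_eq_zero,
    ModuleCat.shortComplex_shortExact _ hex hinj (transpProj_surjective _), inferInstance,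
    inferInstance, ?_, ?_⟩
  · have hfin := finite_generators (syz (resField R))
    have := Fintype.ofFinite (⊤ : Submodule R (syz (resField R))).generators
    have h2 : lam = ∑ i, lam (Finsupp.single i 1) •
        (Finsupp.lapply i : MinCover (syz (resField R)) →ₗ[R] R) := by
      classical
      refine Finsupp.lhom_ext fun j r ↦ ?_
      rw [LinearMap.sum_apply, Finset.sum_eq_single j]
      · rw [LinearMap.smul_apply, Finsupp.lapply_apply, Finsupp.single_eq_same, smul_eq_mul,
          mul_comm, ← smul_eq_mul, ← map_smul, Finsupp.smul_single, smul_eq_mul, mul_one]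
      · intro i _ hij
        rw [LinearMap.smul_apply, Finsupp.lapply_apply, Finsupp.single_eq_of_ne hij, smul_zero]
      · exact fun hj ↦ absurd (Finset.mem_univ _) hj
    change ι (1 : R) ∈ _
    rw [h1, h2]
    refine Submodule.sum_mem _ fun i _ ↦ Submodule.smul_mem_smul ?_ trivial
    rw [← hlam]
    exact ⟨_, rfl⟩
  · intro x hx
    rw [← hlam] at hx
    obtain ⟨v, rfl⟩ := hx
    exact ⟨Module.Dual.eval R _ v, congr($h1 v)⟩

end ResidueField


/-! ### The modules `T_j`: `Ext` computations and maps to and from them -/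

section TransposeSequence

variable {R : Type u} [CommRing R]

lemma exists_linearMap_of_mem_smul_top {G F : Type*} [AddCommGroup G] [Module R G]
    [AddCommGroup F] [Module R F] {I : Ideal R} {v : G}
    (hv : ∀ x ∈ I, ∃ g : G →ₗ[R] R, g v = x) {e : F} (he : e ∈ I • (⊤ : Submodule R F)) :
    ∃ ψ : G →ₗ[R] F, ψ v = e := by
  refine Submodule.smul_induction_on he ?_ ?_
  · intro r hr n _
    obtain ⟨g, rfl⟩ := hv r hr
    exact ⟨g.smulRight n, rfl⟩
  · rintro _ _ ⟨f, rfl⟩ ⟨g, rfl⟩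
    exact ⟨f + g, rfl⟩

lemma apply_mem_of_mem_smul_top {G : Type*} [AddCommGroup G] [Module R G] {I : Ideal R}
    (f : G →ₗ[R] R) {v : G} (hv : v ∈ I • (⊤ : Submodule R G)) : f v ∈ I := by
  refine Submodule.smul_induction_on hv (fun r hr n _ ↦ ?_) fun x y hx hy ↦ ?_
  · rw [map_smul]
    exact I.mul_mem_right _ hr
  · rw [map_add]
    exact I.add_mem hx hy

variable [IsLocalRing R] [IsNoetherianRing R] {t : ℕ}

/-- The short exact sequences linking the consecutive modules `R, Tr k, Tr Ω k, …`. -/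
lemma transpSeq_exact
    (hvan : ∀ i < t, ∀ x : Ext (resField R) (ModuleCat.of R R) i, x = 0) {j : ℕ} (hj : j < t) :
    ∃ (G : ModuleCat.{u} R) (ι : transpSeq R j ⟶ G) (π : G ⟶ transpSeq R (j + 1))
      (w : ι ≫ π = 0), (ShortComplex.mk ι π w).ShortExact ∧ Module.Finite R G ∧ Module.Free R G ∧
        (j = 0 → LinearMap.range ι.hom ≤ maximalIdeal R • (⊤ : Submodule R G)) ∧
        ∀ (F : ModuleCat.{u} R) [Module.Finite R F] [Module.Projective R F]
          (φ : transpSeq R j ⟶ F),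
          (j = 0 → LinearMap.range φ.hom ≤ maximalIdeal R • (⊤ : Submodule R F)) →
            ∃ ψ, ι ≫ ψ = φ := by
  -- The case `j = 0` is exceptional: `Ext^1(Tr k, R)` is not zero but simple, so only maps with
  -- image in `𝔪F` extend.
  cases j with
  | zero =>
    obtain ⟨G, ι, π, w, hS, hfin, hfree, hι, hι'⟩ := transpSeq_zero_exact (hvan 0 hj)
    refine ⟨G, ι, π, w, hS, hfin, hfree, fun _ ↦ ?_, fun F _ _ φ hφ ↦ ?_⟩
    · have hmem : ∀ r : R, ι.hom r ∈ maximalIdeal R • (⊤ : Submodule R G) := fun r ↦ by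
        have : ι.hom (r • (1 : R)) = r • ι.hom (1 : R) := map_smul _ _ _
        rw [smul_eq_mul, mul_one] at this
        rw [this]
        exact Submodule.smul_mem _ r hι
      rintro _ ⟨r, rfl⟩
      exact hmem r
    · obtain ⟨ψ, hψ⟩ := exists_linearMap_of_mem_smul_top hι' (hφ rfl ⟨(1 : R), rfl⟩)
      refine ⟨ModuleCat.ofHom ψ, ModuleCat.hom_ext (LinearMap.ext_ring hψ)⟩
  | succ j =>
    obtain ⟨G, ι, π, w, hS, hfin, hfree, hext⟩ := transpSeq_succ_exact j (hvan (j + 1) hj)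
    refine ⟨G, ι, π, w, hS, hfin, hfree, by simp, fun F _ _ φ _ ↦ ?_⟩
    exact (ext_one_eq_zero_iff hS F).1
      (fun x ↦ ext_projective_eq_zero ((ext_one_eq_zero_iff hS _).2 hext) F x) φ

lemma hasProjectiveDimensionLE_transpSeq
    (hvan : ∀ i < t, ∀ x : Ext (resField R) (ModuleCat.of R R) i, x = 0) {j : ℕ} (hj : j ≤ t) :
    HasProjectiveDimensionLE (transpSeq R j) j := by
  induction j with
  | zero =>
    have : Projective (transpSeq R 0) := inferInstanceAs (Projective (ModuleCat.of R R))
    infer_instance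
  | succ j ih =>
    obtain ⟨G, ι, π, w, hS, _, _, -⟩ := transpSeq_exact hvan (j := j) (by omega)
    exact hS.hasProjectiveDimensionLT_X₃ (j + 1) (ih (by omega))
      (inferInstanceAs (HasProjectiveDimensionLT G (j + 2)))

/-- A power of `x` on `T_j` factors through a free module, and maps from `T_j` to free modules
extend over `ι`. So this power extends to `G`, whence on `T_{j+1}` it factors through `G`. For `j =
0`, multiplication by `x` has image in `𝔪` and extends directly. -/
lemma extPowerTorsion_transpSeq
    (hvan : ∀ i < t, ∀ x : Ext (resField R) (ModuleCat.of R R) i, x = 0) {j : ℕ} (hj : j ≤ t) :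
    ExtPowerTorsion (transpSeq R j) := by
  induction j with
  | zero =>
    have : Projective (transpSeq R 0) := inferInstanceAs (Projective (ModuleCat.of R R))
    exact extPowerTorsion_of_projective _
  | succ j ih =>
    obtain ⟨G, ι, π, w, hS, _, _, -, hext⟩ := transpSeq_exact hvan (j := j) (by omega)
    refine extPowerTorsion_of_factor fun x hx ↦ ?_
    suffices ∃ (n : ℕ) (p : G ⟶ transpSeq R j), ι ≫ p = x ^ n • 𝟙 _ by
      obtain ⟨n, p, hp⟩ := this
      obtain ⟨f, hf⟩ := exists_factor_X₃ hS p hp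
      exact ⟨n, G, inferInstance, f, π, hf⟩
    rcases Nat.eq_zero_or_pos j with rfl | hj0
    · have : Module.Projective R (transpSeq R 0) := inferInstanceAs (Module.Projective R R)
      refine ⟨1, hext (transpSeq R 0) (x ^ 1 • 𝟙 _) fun _ ↦ ?_⟩
      rintro _ ⟨r, rfl⟩
      rw [pow_one]
      exact Submodule.smul_mem_smul hx trivial
    · obtain ⟨n, f, hf⟩ := (ih (by omega)).exists_section
        (shortExact_syz (transpSeq R j)) (𝟙 _) hx
      obtain ⟨f', hf'⟩ := hext (ModuleCat.of R (MinCover (transpSeq R j))) f (by omega)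
      refine ⟨n, f' ≫ (syzSequence (transpSeq R j)).g, ?_⟩
      rw [reassoc_of% hf']
      exact hf

lemma ext_transpSeq_eq_zero
    (hvan : ∀ i < t, ∀ x : Ext (resField R) (ModuleCat.of R R) i, x = 0) {j : ℕ} (hj : j ≤ t)
    {i : ℕ} (hi : i + 1 < j) (x : Ext (transpSeq R j) (ModuleCat.of R R) (i + 1)) : x = 0 := by
  induction j generalizing i with
  | zero => omega
  | succ j ih =>
    obtain ⟨G, ι, π, w, hS, _, _, -, hext⟩ := transpSeq_exact hvan (j := j) (by omega)
    have : Projective (ShortComplex.mk ι π w).X₂ := inferInstanceAs (Projective G)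
    cases i with
    | zero => exact (ext_one_eq_zero_iff hS _).2 (fun f ↦ hext _ f (by omega)) x
    | succ i => exact (ext_X₃_eq_zero_iff hS _ i).2 (fun y ↦ ih (by omega) (by omega) y) x

/-- The extension class generates, and `r` kills it exactly when `r • 𝟙` extends over `ι`, that is,
when `r ∈ 𝔪`. -/
lemma isSimpleModule_ext_one {R : Type u} [CommRing R] [IsLocalRing R] {G T : ModuleCat.{u} R}
    [Projective G] {ι : ModuleCat.of R R ⟶ G} {π : G ⟶ T} {w : ι ≫ π = 0}
    (hS : (ShortComplex.mk ι π w).ShortExact)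
    (hι : LinearMap.range ι.hom ≤ maximalIdeal R • (⊤ : Submodule R G))
    (hext : ∀ r ∈ maximalIdeal R, ∃ ψ, ι ≫ ψ = r • 𝟙 _) :
    IsSimpleModule R (Ext T (ModuleCat.of R R) 1) := by
  have : Projective (ShortComplex.mk ι π w).X₂ := inferInstanceAs (Projective G)
  let c : Ext (T) (ModuleCat.of R R) 1 := hS.extClass
  have hc : ∀ r : R, r • c = hS.extClass.comp (Ext.mk₀ (r • 𝟙 (ModuleCat.of R R)))
      (add_zero 1) := fun r ↦ Ext.smul_eq_comp_mk₀ _ _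
  have hzero : ∀ r : R, r • c = 0 ↔ ∃ ψ : G ⟶ ModuleCat.of R R, ι ≫ ψ = r • 𝟙 _ := by
    intro r
    rw [hc]
    constructor
    · intro h
      obtain ⟨y, hy⟩ := Ext.contravariant_sequence_exact₁ hS _ _ (add_zero 1) h
      obtain ⟨ψ, rfl⟩ := (Ext.mk₀_bijective _ _).2 y
      rw [Ext.mk₀_comp_mk₀] at hy
      exact ⟨ψ, (Ext.mk₀_bijective _ _).1 hy⟩
    · rintro ⟨ψ, hψ⟩
      rw [← hψ, ← Ext.mk₀_comp_mk₀]
      exact hS.extClass_comp_assoc _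
  rw [isSimpleModule_iff_quot_maximal]
  let L := LinearMap.toSpanSingleton R (Ext (T) (ModuleCat.of R R) 1) c
  have hL : Function.Surjective L := by
    intro x
    obtain ⟨y, rfl⟩ := extClass_comp_surjective hS _ (add_zero 1) x
    obtain ⟨f, rfl⟩ := (Ext.mk₀_bijective _ _).2 y
    refine ⟨f.hom (1 : R), ?_⟩
    rw [LinearMap.toSpanSingleton_apply, hc]
    congr 2
    refine ModuleCat.hom_ext (LinearMap.ext_ring ?_)
    exact mul_one _
  have hker : LinearMap.ker L = maximalIdeal R := by
    refine le_antisymm (le_maximalIdeal fun h ↦ ?_) fun r hr ↦ (hzero r).2 ?_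
    · have h1 : (1 : R) ∈ LinearMap.ker L := h ▸ trivial
      obtain ⟨ψ, hψ⟩ := (hzero 1).1 h1
      have h2 : ψ.hom (ι.hom (1 : R)) ∈ maximalIdeal R :=
        apply_mem_of_mem_smul_top ψ.hom (hι ⟨(1 : R), rfl⟩)
      have h3 : ψ.hom (ι.hom (1 : R)) = (1 : R) • (1 : R) := congr(($hψ).hom (1 : R))
      rw [h3, one_smul] at h2
      exact (Ideal.ne_top_iff_one _).1 (maximalIdeal.isMaximal R).ne_top h2
    · exact hext r hr
  exact ⟨LinearMap.ker L, hker ▸ maximalIdeal.isMaximal R,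
    ⟨(L.quotKerEquivOfSurjective hL).symm⟩⟩

lemma isSimpleModule_ext_transpSeq
    (hvan : ∀ i < t, ∀ x : Ext (resField R) (ModuleCat.of R R) i, x = 0) {j : ℕ} (hj : j < t) :
    IsSimpleModule R (Ext (transpSeq R (j + 1)) (ModuleCat.of R R) (j + 1)) := by
  induction j with
  | zero =>
    obtain ⟨G, ι, π, w, hS, _, _, hι, hext⟩ := transpSeq_exact hvan hj
    exact isSimpleModule_ext_one hS (hι rfl) fun r hr ↦ hext (ModuleCat.of R R) (r • 𝟙 _) fun _ ↦ by
      rintro _ ⟨s, rfl⟩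
      exact Submodule.smul_mem_smul hr trivial
  | succ j ih =>
    obtain ⟨G, ι, π, w, hS, _, _, -⟩ := transpSeq_exact hvan hj
    have : Projective (ShortComplex.mk ι π w).X₂ := inferInstanceAs (Projective G)
    have := ih (by omega)
    exact IsSimpleModule.congr (extShift hS (ModuleCat.of R R) j).symm

/-- Represent `e` by `φ : S.X₁ ⟶ R`. The entries of `ι` lie in `𝔪`, which kills `e`, so the
pushforward of `e` along `ι` is zero. Thus `φ ≫ ι` extends to `S.X₂ ⟶ G`, and the induced map on
cokernels pulls the class of the second sequence back to `e`. -/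
lemma exists_map_of_socle {S : ShortComplex (ModuleCat.{u} R)} (hS : S.ShortExact)
    [Projective S.X₂] {G T : ModuleCat.{u} R} {ι : ModuleCat.of R R ⟶ G} {π : G ⟶ T}
    {w : ι ≫ π = 0} (hS' : (ShortComplex.mk ι π w).ShortExact)
    (hι : LinearMap.range ι.hom ≤ maximalIdeal R • (⊤ : Submodule R G))
    (e : Ext S.X₃ (ModuleCat.of R R) 1) (he : ∀ x ∈ maximalIdeal R, x • e = 0) :
    ∃ (g : S.X₃ ⟶ T) (f : Ext T (ModuleCat.of R R) 1),
      (Ext.mk₀ g).comp f (zero_add _) = e := by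
  obtain ⟨y, rfl⟩ := extClass_comp_surjective hS _ (add_zero 1) e
  obtain ⟨φ, rfl⟩ := (Ext.mk₀_bijective _ _).2 y
  obtain ⟨s, κ, hs, hκ⟩ := exists_eq_sum_smul ι (IsNoetherian.noetherian (maximalIdeal R)) hι
  have hz : (hS.extClass.comp (Ext.mk₀ φ) (add_zero 1)).comp (Ext.mk₀ ι) (add_zero 1) = 0 := by
    rw [hκ, Ext.mk₀_sum, Ext.comp_sum]
    refine Finset.sum_eq_zero fun i _ ↦ ?_
    rw [Ext.mk₀_smul, Ext.comp_smul, ← Ext.smul_comp]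
    rw [he i (hs i i.2), Ext.zero_comp]
  have hz' : hS.extClass.comp (Ext.mk₀ (φ ≫ ι)) (add_zero 1) = 0 := by
    rw [← hz, ← Ext.mk₀_comp_mk₀, Ext.comp_assoc_of_third_deg_zero]
  obtain ⟨y, hy⟩ := Ext.contravariant_sequence_exact₁ hS _ _ (add_zero 1) hz'
  obtain ⟨ψ, rfl⟩ := (Ext.mk₀_bijective _ _).2 y
  rw [Ext.mk₀_comp_mk₀] at hy
  obtain ⟨g, hg⟩ := exists_map_X₃ hS hS' φ ψ ((Ext.mk₀_bijective _ _).1 hy).symm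
  exact ⟨g, hS'.extClass, hg.symm⟩

/-- A socle element of the first nonvanishing `Ext^{j+1}(M, R)` is induced by a morphism from `M`
to `Tr Ω^j k`. -/
lemma exists_map_to_transpSeq
    (hvan : ∀ i < t, ∀ x : Ext (resField R) (ModuleCat.of R R) i, x = 0) {j : ℕ} (hj : j < t)
    (M : ModuleCat.{u} R) [Module.Finite R M]
    (hM : ∀ i < j, ∀ x : Ext M (ModuleCat.of R R) (i + 1), x = 0)
    (e : Ext M (ModuleCat.of R R) (j + 1)) (he : ∀ x ∈ maximalIdeal R, x • e = 0) :
    ∃ (g : M ⟶ transpSeq R (j + 1)) (f : Ext (transpSeq R (j + 1)) (ModuleCat.of R R) (j + 1)),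
      (Ext.mk₀ g).comp f (zero_add _) = e := by
  induction j generalizing M with
  | zero =>
    obtain ⟨G, ι, π, w, hS', _, _, hι, -⟩ := transpSeq_exact hvan hj
    have hS := shortExact_syz M
    exact exists_map_of_socle hS hS' (hι rfl) e he
  | succ j ih =>
    obtain ⟨G, ι, π, w, hS', _, _, -⟩ := transpSeq_exact hvan hj
    have hS := shortExact_syz M
    obtain ⟨e', rfl⟩ := extClass_comp_surjective hS _ (n := j + 1) (by omega) e
    obtain ⟨g', f', hgf⟩ := ih (by omega) (syz M)
      (fun i hi ↦ (ext_X₃_eq_zero_iff hS _ i).1 (hM (i + 1) (by omega))) e' fun x hx ↦ by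
        refine extClass_comp_injective hS _ (m := j + 2) (by omega) ?_
        rw [Ext.comp_smul]
        exact he x hx
    -- Since `Ext^1(M, R) = 0`, the map from the syzygy to `G` extends to the free cover of `M`.
    obtain ⟨ψ, hψ⟩ := (ext_one_eq_zero_iff hS G).1
      (ext_projective_eq_zero (hM 0 (by omega)) G) (g' ≫ ι)
    obtain ⟨g, hg⟩ := exists_map_X₃ hS hS' g' ψ hψ.symm
    refine ⟨g, hS'.extClass.comp f' (by omega), ?_⟩
    subst hgf
    rw [← Ext.comp_assoc (a₁₂ := 1) _ _ _ (by omega) (by omega) (by omega)]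
    refine Eq.trans ?_ (Ext.comp_assoc (a₁₂ := 1) _ _ _ (by omega) (by omega) (by omega))
    exact congrArg (fun z ↦ Ext.comp z f' _) hg.symm

/-- A module of projective dimension exactly `j` receives a morphism from `Tr Ω^{j-1} k` which
is surjective on `Ext^j(-, R)`. -/
lemma exists_map_from_transpSeq
    (hvan : ∀ i < t, ∀ x : Ext (resField R) (ModuleCat.of R R) i, x = 0) {j : ℕ} (hj : j ≤ t)
    (M : ModuleCat.{u} R) [Module.Finite R M] (hM : HasProjectiveDimensionLE M j)
    (hM' : ¬ HasProjectiveDimensionLT M j) :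
    ∃ h : transpSeq R j ⟶ M, ∀ y : Ext (transpSeq R j) (ModuleCat.of R R) j,
      ∃ z : Ext M (ModuleCat.of R R) j, (Ext.mk₀ h).comp z (zero_add _) = y := by
  induction j generalizing M with
  | zero =>
    have : Projective M := (projective_iff_hasProjectiveDimensionLE_zero M).2 hM
    have : Module.Projective R M := (IsProjective.iff_projective M).2 this
    have : Nontrivial M := by
      rw [← not_subsingleton_iff_nontrivial, ← ModuleCat.isZero_iff_subsingleton]
      exact fun hz ↦ hM' hz.hasProjectiveDimensionLT_zero
    obtain ⟨f, g, hfg⟩ := exists_split_of_projective M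
    have key : ∀ y : Ext (ModuleCat.of R R) (ModuleCat.of R R) 0,
        ∃ z : Ext M (ModuleCat.of R R) 0, (Ext.mk₀ f).comp z (zero_add _) = y := fun y ↦
      ⟨(Ext.mk₀ g).comp y (zero_add _), by rw [Ext.mk₀_comp_mk₀_assoc, hfg, Ext.mk₀_id_comp]⟩
    exact ⟨f, key⟩
  | succ j ih =>
    obtain ⟨G, ι, π, w, hS', _, _, -, hext⟩ := transpSeq_exact hvan (j := j) hj
    have : Projective (ShortComplex.mk ι π w).X₂ := inferInstanceAs (Projective G)
    have hS := shortExact_syz M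
    have hN : HasProjectiveDimensionLE (syz M) j :=
      hS.hasProjectiveDimensionLT_X₁ (j + 1) inferInstance hM
    obtain ⟨h', hh'⟩ := ih (by omega) (syz M) hN fun hN' ↦
      hM' (hS.hasProjectiveDimensionLT_X₃ j hN' inferInstance)
    -- The image condition needed when `j = 0` is supplied by minimality of the cover.
    obtain ⟨ψ, hψ⟩ := hext (ModuleCat.of R (MinCover M)) (h' ≫ ModuleCat.ofHom (syzIncl M)) (by
      rintro - _ ⟨x, rfl⟩
      exact ker_minCover_le M (h'.hom x).2)
    obtain ⟨h, hh⟩ := exists_map_X₃ hS' hS h' ψ hψ.symm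
    refine ⟨h, fun y ↦ ?_⟩
    obtain ⟨y', rfl⟩ := extClass_comp_surjective hS' _ (n := j) (by omega) y
    obtain ⟨z, rfl⟩ := hh' y'
    refine ⟨hS.extClass.comp z (by omega), ?_⟩
    rw [← Ext.comp_assoc (a₁₂ := 1) _ _ _ (by omega) (by omega) (by omega)]
    refine Eq.trans ?_ (Ext.comp_assoc (a₁₂ := 1) _ _ _ (by omega) (by omega) (by omega))
    exact congrArg (fun z' ↦ Ext.comp z' z _) hh.symm

end TransposeSequence


/-! ### Killing a socle element of `Ext` -/

section SocleReduction

variable {R : Type u} [CommRing R]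

/-- An associated prime is the annihilator of some `e`; it contains a power of each `x ∈ 𝔪`, hence
contains `𝔪`. -/
lemma exists_socle_element [IsLocalRing R] [IsNoetherianRing R] (E : Type*) [AddCommGroup E]
    [Module R E] [Nontrivial E] (h : ∀ x ∈ maximalIdeal R, ∃ n : ℕ, ∀ y : E, x ^ n • y = 0) :
    ∃ e : E, e ≠ 0 ∧ ∀ x ∈ maximalIdeal R, x • e = 0 := by
  obtain ⟨p, hp⟩ := associatedPrimes.nonempty R E
  obtain ⟨hprime, e, he⟩ := Submodule.isAssociatedPrime_iff.1 hp
  have hmem : ∀ x : R, x ∈ p ↔ x • e = 0 := fun x ↦ by simp [he, Submodule.mem_colon_singleton]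
  refine ⟨e, fun h0 ↦ hprime.ne_top ?_, fun x hx ↦ ?_⟩
  · rw [Ideal.eq_top_iff_one, hmem, h0, smul_zero]
  · obtain ⟨n, hn⟩ := h x hx
    exact (hmem x).1 (hprime.mem_of_pow_mem n ((hmem _).2 (hn e)))

lemma mk₀_biprod_total {M F Y : ModuleCat.{u} R} [Projective F] {i : ℕ}
    (y : Ext (M ⊞ F) Y (i + 1)) :
    (Ext.mk₀ biprod.fst).comp ((Ext.mk₀ biprod.inl).comp y (zero_add _)) (zero_add _) = y := by
  have h : (Ext.mk₀ (biprod.inr : F ⟶ M ⊞ F)).comp y (zero_add _) = 0 :=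
    Ext.eq_zero_of_projective _
  conv_rhs => rw [← y.mk₀_id_comp, ← biprod.total, Ext.mk₀_add, Ext.add_comp,
    ← Ext.mk₀_comp_mk₀_assoc, ← Ext.mk₀_comp_mk₀_assoc, h, Ext.comp_zero, add_zero]

variable {M F T K : ModuleCat.{u} R} {g : M ⟶ T} {π : F ⟶ T} {ι : K ⟶ M ⊞ F}
  {w : ι ≫ biprod.desc g π = 0}

lemma mk₀_comp_extClass_comp {Y : ModuleCat.{u} R} {i : ℕ}
    (hS : (ShortComplex.mk ι (biprod.desc g π) w).ShortExact) (x : Ext K Y i) :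
    (Ext.mk₀ g).comp (hS.extClass.comp x (add_comm 1 i)) (zero_add _) = 0 := by
  have h : (Ext.mk₀ (biprod.desc g π)).comp (hS.extClass.comp x (add_comm 1 i)) (zero_add _) = 0 :=
    hS.comp_extClass_assoc x (add_comm 1 i)
  have h2 := congrArg (fun z ↦ (Ext.mk₀ (biprod.inl : M ⟶ M ⊞ F)).comp z (zero_add _)) h
  simpa only [Ext.mk₀_comp_mk₀_assoc, biprod.inl_desc, Ext.comp_zero] using h2

variable [Projective F]

lemma comp_ι_fst_eq_zero {Y : ModuleCat.{u} R} {i : ℕ} (w : ι ≫ biprod.desc g π = 0)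
    (f : Ext T Y (i + 1)) :
    (Ext.mk₀ (ι ≫ biprod.fst)).comp ((Ext.mk₀ g).comp f (zero_add _)) (zero_add _) = 0 := by
  have h : (Ext.mk₀ π).comp f (zero_add _) = 0 := Ext.eq_zero_of_projective _
  have h2 : ι ≫ biprod.fst ≫ g = - (ι ≫ biprod.snd ≫ π) := by
    rw [biprod.desc_eq, Preadditive.comp_add] at w
    exact eq_neg_of_add_eq_zero_left w
  rw [Ext.mk₀_comp_mk₀_assoc, Category.assoc, h2, Ext.mk₀_neg, Ext.neg_comp, ← Category.assoc,
    ← Ext.mk₀_comp_mk₀_assoc, h, Ext.comp_zero, neg_zero]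

lemma exists_comp_ι_fst_eq {Y : ModuleCat.{u} R} {i : ℕ}
    (hS : (ShortComplex.mk ι (biprod.desc g π) w).ShortExact) (x : Ext K Y (i + 1))
    (hx : hS.extClass.comp x (add_comm 1 (i + 1)) = 0) :
    ∃ y : Ext M Y (i + 1), (Ext.mk₀ (ι ≫ biprod.fst)).comp y (zero_add _) = x := by
  obtain ⟨y, rfl⟩ := Ext.contravariant_sequence_exact₁ hS Y x (add_comm 1 (i + 1)) hx
  refine ⟨(Ext.mk₀ biprod.inl).comp y (zero_add _), ?_⟩
  rw [← Ext.mk₀_comp_mk₀_assoc, mk₀_biprod_total]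

/-- One step of the reduction: a socle element `e` of the first nonvanishing `Ext^{j+1}(M, R)` is
killed by passing to the kernel of a surjection `M ⊕ F → Tr Ω^j k`. -/
lemma exists_socle_reduction [IsLocalRing R] [IsNoetherianRing R] {t : ℕ}
    (hvan : ∀ i < t, ∀ x : Ext (resField R) (ModuleCat.of R R) i, x = 0) {n j : ℕ} (hj : j < n)
    (hn : n ≤ t) (M : ModuleCat.{u} R) [Module.Finite R M] (hpd : HasProjectiveDimensionLE M n)
    (htor : ExtPowerTorsion M) (hM : ∀ i < j, ∀ x : Ext M (ModuleCat.of R R) (i + 1), x = 0)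
    (e : Ext M (ModuleCat.of R R) (j + 1)) (he : ∀ x ∈ maximalIdeal R, x • e = 0) (he0 : e ≠ 0) :
    ∃ (F K : ModuleCat.{u} R) (ι : K ⟶ M ⊞ F) (π : M ⊞ F ⟶ transpSeq R (j + 1)) (w : ι ≫ π = 0),
      (ShortComplex.mk ι π w).ShortExact ∧ Module.Finite R K ∧ HasProjectiveDimensionLE K n ∧
      ExtPowerTorsion K ∧ (∀ i < j, ∀ x : Ext K (ModuleCat.of R R) (i + 1), x = 0) ∧
      ∃ φ : Ext M (ModuleCat.of R R) (j + 1) →ₗ[R] Ext K (ModuleCat.of R R) (j + 1),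
        Function.Surjective φ ∧ φ e = 0 := by
  obtain ⟨g, f, rfl⟩ := exists_map_to_transpSeq hvan (by omega) M hM e he
  obtain ⟨F, K, π, ι, w, hS, _, _, hK⟩ := exists_shortExact_biprod g
  have hTn : HasProjectiveDimensionLE (transpSeq R (j + 1)) (j + 1) :=
    hasProjectiveDimensionLE_transpSeq hvan (by omega)
  have hTn' : HasProjectiveDimensionLT (transpSeq R (j + 1)) (n + 1 + 1) :=
    hasProjectiveDimensionLT_of_ge _ (j + 2) _ (by omega)
  have hFn : HasProjectiveDimensionLT F (n + 1) :=
    hasProjectiveDimensionLT_of_ge _ 1 _ (by omega)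
  have hMn : HasProjectiveDimensionLT M (n + 1) := hpd
  have hMF : HasProjectiveDimensionLT (M ⊞ F) (n + 1) := inferInstance
  have hMFtor : ExtPowerTorsion (M ⊞ F : ModuleCat.{u} R) :=
    ExtPowerTorsion.X₂ (ShortComplex.Splitting.ofHasBinaryBiproduct M F).shortExact htor
      (extPowerTorsion_of_projective F)
  have hTtor : ExtPowerTorsion (transpSeq R (j + 1)) :=
    extPowerTorsion_transpSeq hvan (by omega)
  -- The source is simple and the map takes `f` to `e ≠ 0`.
  have hg : Function.Injective ((Ext.mk₀ g).precompOfLinear R (ModuleCat.of R R)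
      (zero_add (j + 1))) := by
    have := isSimpleModule_ext_transpSeq hvan (j := j) (by omega)
    refine (LinearMap.injective_or_eq_zero _).resolve_right fun h0 ↦ he0 ?_
    exact congr($h0 f)
  refine ⟨F, K, ι, biprod.desc g π, w, hS, hK, hS.hasProjectiveDimensionLT_X₁ (n + 1) hMF hTn',
    ExtPowerTorsion.X₁ hS hMFtor hTtor,
    fun i hi x ↦ ?_, (Ext.mk₀ (ι ≫ biprod.fst)).precompOfLinear R _ (zero_add _), fun x ↦ ?_, ?_⟩
  -- The connecting map lands in `Ext^{i+2}(T_{j+1}, R)`, which is zero for `i + 2 ≤ j`; for `i + 2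
  -- = j + 1` it lands in the kernel of the injective map induced by `g`.
  · have hx : hS.extClass.comp x (add_comm 1 (i + 1)) = 0 := by
      rcases Nat.lt_or_ge (i + 1) j with h | h
      · exact ext_transpSeq_eq_zero hvan (j := j + 1) (i := i + 1) (by omega) (by omega) _
      · obtain rfl : j = i + 1 := by omega
        exact (injective_iff_map_eq_zero _).1 hg _ (mk₀_comp_extClass_comp hS x)
    obtain ⟨y, rfl⟩ := exists_comp_ι_fst_eq hS x hx
    rw [hM i hi y, Ext.comp_zero]
  · exact exists_comp_ι_fst_eq hS x (Ext.eq_zero_of_hasProjectiveDimensionLT _ (j + 2) le_rfl)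
  · exact comp_ι_fst_eq_zero w f

end SocleReduction


/-! ### Extension-closed subcategories -/

section ExtensionClosed

variable {R : Type u} [CommRing R] {P : ObjectProperty (ModuleCat.{u} R)}

/-- The retract given by a linear map with a left inverse. -/
def retractOfLeftInverse {M N : ModuleCat.{u} R} (f : M →ₗ[R] N) (g : N →ₗ[R] M)
    (h : Function.LeftInverse g f) : Retract M N where
  i := ModuleCat.ofHom f
  r := ModuleCat.ofHom g
  retract := ModuleCat.hom_ext (LinearMap.ext h)

lemma IsExtensionClosed.prop_of_leftInverse (hP : IsExtensionClosed P) {M N : ModuleCat.{u} R}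
    (f : M →ₗ[R] N) (g : N →ₗ[R] M) (h : Function.LeftInverse g f) (hN : P N) : P M :=
  hP.retracts.of_retract (retractOfLeftInverse f g h) hN

lemma IsExtensionClosed.prop_prod (hP : IsExtensionClosed P) {M N : ModuleCat.{u} R} (hM : P M)
    (hN : P N) : P (ModuleCat.of R (M × N)) := by
  have := hP.extensions
  have := hP.retracts
  exact P.prop_of_iso (ModuleCat.biprodIsoProd M N) (P.prop_biprod hM hN)

lemma IsExtensionClosed.prop_pi (hP : IsExtensionClosed P) (hR : P (ModuleCat.of R R)) {n : ℕ}
    (M : Fin n → ModuleCat.{u} R) (hM : ∀ i, P (M i)) : P (ModuleCat.of R (∀ i, M i)) := by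
  induction n with
  | zero => exact hP.prop_of_leftInverse (0 : _ →ₗ[R] R) 0 (fun _ ↦ Subsingleton.elim _ _) hR
  | succ n ih =>
    let e := Fin.consLinearEquiv R (fun i ↦ M i)
    exact hP.prop_of_leftInverse (M := ModuleCat.of R (∀ i, M i))
      (N := ModuleCat.of R (M 0 × ∀ i : Fin n, M i.succ)) e.symm.toLinearMap e.toLinearMap
      e.apply_symm_apply (hP.prop_prod (hM 0) (ih (fun i ↦ M i.succ) fun i ↦ hM i.succ))

lemma addClosure_self_iff (M : ModuleCat.{u} R) :
    addClosure (ModuleCat.of R R) M ↔ Module.Finite R M ∧ Module.Projective R M := by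
  constructor
  · rintro ⟨n, ⟨r⟩⟩
    let f : M →ₗ[R] (Fin n → R) := r.i.hom
    let g : (Fin n → R) →ₗ[R] M := r.r.hom
    have hgf : ∀ x, g (f x) = x := fun x ↦ congr(($r.retract).hom x)
    exact ⟨Module.Finite.of_surjective g fun x ↦ ⟨_, hgf x⟩,
      Module.Projective.of_split f g (LinearMap.ext hgf)⟩
  · rintro ⟨_, _⟩
    obtain ⟨n, f, g, -, -, h⟩ := Module.Finite.exists_comp_eq_id_of_projective R M
    exact ⟨n, ⟨retractOfLeftInverse (N := ModuleCat.of R (Fin n → R)) g f fun x ↦ congr($h x)⟩⟩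

lemma IsExtensionClosed.prop_of_projective (hP : IsExtensionClosed P)
    (hR : P (ModuleCat.of R R)) (M : ModuleCat.{u} R) [Module.Finite R M] [Module.Projective R M] :
    P M := by
  obtain ⟨n, ⟨r⟩⟩ := (addClosure_self_iff M).2 ⟨‹_›, ‹_›⟩
  exact hP.retracts.of_retract r (hP.prop_pi hR (fun _ : Fin n ↦ ModuleCat.of R R) fun _ ↦ hR)

end ExtensionClosed

/-! ### The subcategories `PD₀ⁿ(R)` and their generation -/

section Filtration

variable {R : Type u} [CommRing R] [IsLocalRing R] [IsNoetherianRing R]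
  {P : ObjectProperty (ModuleCat.{u} R)}

lemma pdZeroLE_iff {n : ℕ} {M : ModuleCat.{u} R} : PDZeroLE R n M ↔
    Module.Finite R M ∧ HasProjectiveDimensionLE M n ∧ ExtPowerTorsion M :=
  ⟨fun ⟨_, h₂, h₃⟩ ↦ ⟨‹_›, h₂, extPowerTorsion_of_locFreePunctured h₃⟩,
    fun ⟨_, h₂, h₃⟩ ↦ ⟨‹_›, h₂, locFreePunctured_of_extPowerTorsion h₃⟩⟩

lemma pdZeroLE_mono {R : Type u} [CommRing R] [IsLocalRing R] {m n : ℕ}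
    (h : m ≤ n) : PDZeroLE R m ≤ PDZeroLE R n :=
  fun M ⟨h₁, h₂, h₃⟩ ↦
    ⟨h₁, @hasProjectiveDimensionLT_of_ge _ _ _ M (m + 1) (n + 1) (by omega) h₂, h₃⟩

variable (R) in
lemma isExtensionClosed_pdZeroLE (n : ℕ) : IsExtensionClosed (PDZeroLE R n) where
  le_isFG _ h := h.1
  retracts := ⟨fun {M N} r h ↦ by
    obtain ⟨_, h₂, h₃⟩ := pdZeroLE_iff.1 h
    exact pdZeroLE_iff.2 ⟨Module.Finite.of_surjective r.r.hom
      fun x ↦ ⟨r.i.hom x, congr(($r.retract).hom x)⟩, r.hasProjectiveDimensionLT (n + 1),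
      h₃.of_retract r⟩⟩
  extensions := ⟨fun {S} hS h h' ↦ by
    obtain ⟨_, h₂, h₃⟩ := pdZeroLE_iff.1 h
    obtain ⟨_, h₂', h₃'⟩ := pdZeroLE_iff.1 h'
    have hsurj : Function.Surjective S.g.hom := hS.moduleCat_surjective_g
    have hex : Function.Exact S.f.hom S.g.hom :=
      (ShortComplex.ShortExact.moduleCat_exact_iff_function_exact S).1 hS.exact
    exact pdZeroLE_iff.2 ⟨Module.Finite.of_exact hex hsurj,
      hS.hasProjectiveDimensionLT_X₂ (n + 1) h₂ h₂', .X₂ hS h₃ h₃'⟩⟩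

lemma pdZeroLE_of_projective (n : ℕ) (M : ModuleCat.{u} R) [Module.Finite R M]
    [Module.Projective R M] : PDZeroLE R n M := by
  have : Projective M := (IsProjective.iff_projective M).1 ‹_›
  exact pdZeroLE_iff.2 ⟨‹_›, hasProjectiveDimensionLT_of_ge _ 1 _ (by omega),
    extPowerTorsion_of_projective M⟩

variable (R) in
lemma isResolving_pdZeroLE (n : ℕ) : IsResolving (PDZeroLE R n) where
  toIsExtensionClosed := isExtensionClosed_pdZeroLE R n
  projectives F _ _ := pdZeroLE_of_projective n F
  syzygies S hS _ _ h := by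
    obtain ⟨_, h₂, h₃⟩ := pdZeroLE_iff.1 h
    have hF := pdZeroLE_iff.1 (pdZeroLE_of_projective n S.X₂)
    exact pdZeroLE_iff.2 ⟨Module.Finite.of_injective S.f.hom hS.moduleCat_injective_f,
      hS.hasProjectiveDimensionLT_X₁ (n + 1) hF.2.1
        (hasProjectiveDimensionLT_of_ge _ (n + 1) _ (by omega)), .X₁ hS hF.2.2 h₃⟩

lemma hasProjectiveDimensionLE_of_forall_ext_eq_zero {R : Type u} [CommRing R]
    [IsNoetherianRing R] {n k : ℕ} {M : ModuleCat.{u} R} [Module.Finite R M]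
    (hM : HasProjectiveDimensionLE M (k + n))
    (h : ∀ i < n, ∀ x : Ext M (ModuleCat.of R R) (k + i + 1), x = 0) :
    HasProjectiveDimensionLE M k := by
  induction n with
  | zero => exact hM
  | succ n ih =>
    exact ih (hasProjectiveDimensionLE_of_ext_eq_zero hM (h n (by omega)))
      fun i hi ↦ h i (by omega)

variable {t : ℕ}

lemma pdZeroLE_transpSeq
    (hvan : ∀ i < t, ∀ x : Ext (resField R) (ModuleCat.of R R) i, x = 0) {j : ℕ} (hj : j ≤ t) :
    PDZeroLE R j (transpSeq R j) :=
  pdZeroLE_iff.2 ⟨inferInstance, hasProjectiveDimensionLE_transpSeq hvan hj,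
    extPowerTorsion_transpSeq hvan hj⟩

lemma not_hasProjectiveDimensionLT_transpSeq
    (hvan : ∀ i < t, ∀ x : Ext (resField R) (ModuleCat.of R R) i, x = 0) {j : ℕ} (hj : j < t) :
    ¬ HasProjectiveDimensionLT (transpSeq R (j + 1)) (j + 1) := by
  intro h
  have := isSimpleModule_ext_transpSeq hvan hj
  have := IsSimpleModule.nontrivial R (Ext (transpSeq R (j + 1)) (ModuleCat.of R R) (j + 1))
  obtain ⟨x, hx⟩ := exists_ne (0 : Ext (transpSeq R (j + 1)) (ModuleCat.of R R) (j + 1))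
  exact hx (Ext.eq_zero_of_hasProjectiveDimensionLT _ (j + 1) le_rfl)

/-- An extension-closed subcategory containing `R` and the transposes `Tr Ω^i k` for `i < n`
contains every module in `PD₀ⁿ(R)` whose first `j` modules `Ext^{i+1}(-, R)` vanish. -/
lemma IsExtensionClosed.prop_of_ext_eq_zero
    (hvan : ∀ i < t, ∀ x : Ext (resField R) (ModuleCat.of R R) i, x = 0)
    (hP : IsExtensionClosed P) (hR : P (ModuleCat.of R R)) {n : ℕ} (hn : n ≤ t)
    (hT : ∀ i < n, P (transpSeq R (i + 1))) (d j : ℕ) (hd : j + d = n) (M : ModuleCat.{u} R)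
    [Module.Finite R M] (hpd : HasProjectiveDimensionLE M n) (htor : ExtPowerTorsion M)
    (hM : ∀ i < j, ∀ x : Ext M (ModuleCat.of R R) (i + 1), x = 0) : P M := by
  induction d generalizing j M with
  | zero =>
    have h0 : HasProjectiveDimensionLE M 0 :=
      hasProjectiveDimensionLE_of_forall_ext_eq_zero (n := n) (by rwa [zero_add])
        fun i hi x ↦ by
          obtain ⟨y, hy⟩ : ∃ y : ℕ, y = 0 + i := ⟨_, rfl⟩
          revert x
          rw [← hy]
          exact hM y (by omega)
    have : Module.Projective R M :=
      (IsProjective.iff_projective M).2 ((projective_iff_hasProjectiveDimensionLE_zero M).2 h0)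
    exact hP.prop_of_projective hR M
  | succ d ih =>
    -- `M` changes along the reduction, so the Noetherian induction runs over kernels of surjections
    -- from a fixed module `E` onto `Ext^{j+1}(M, R)`.
    suffices ∀ (E : Type u) [AddCommGroup E] [Module R E] [Module.Finite R E]
        (N : Submodule R E) (M : ModuleCat.{u} R) [Module.Finite R M]
        (_ : HasProjectiveDimensionLE M n) (_ : ExtPowerTorsion M)
        (_ : ∀ i < j, ∀ x : Ext M (ModuleCat.of R R) (i + 1), x = 0)
        (φ : E →ₗ[R] Ext M (ModuleCat.of R R) (j + 1)) (_ : Function.Surjective φ)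
        (_ : LinearMap.ker φ = N), P M from
      this (Ext M (ModuleCat.of R R) (j + 1)) _ M hpd htor hM LinearMap.id
        Function.surjective_id rfl
    intro E _ _ _ N
    induction N using WellFoundedGT.induction with
    | ind N ihN =>
    intro M _ hpd htor hM φ hφ hN
    rcases subsingleton_or_nontrivial (Ext M (ModuleCat.of R R) (j + 1)) with hsub | hnon
    · refine ih (j + 1) (by omega) M hpd htor fun i hi ↦ ?_
      rcases Nat.lt_succ_iff_lt_or_eq.1 hi with h | rfl
      · exact hM i h
      · exact fun x ↦ Subsingleton.elim _ _
    · obtain ⟨e, he0, he⟩ := exists_socle_element (R := R)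
        (Ext M (ModuleCat.of R R) (j + 1)) fun x hx ↦ by
          obtain ⟨k, hk⟩ := htor x hx
          exact ⟨k, fun y ↦ hk j _ y⟩
      obtain ⟨F, K, ι, π, w, hS, _, hKpd, hKtor, hK, ψ, hψ, hψe⟩ :=
        exists_socle_reduction hvan (by omega : j < n) hn M hpd htor hM e he he0
      have hPK : P K := by
        -- The kernel grows strictly: it gains a preimage of `e`.
        refine ihN (LinearMap.ker (ψ ∘ₗ φ)) ?_ K hKpd hKtor hK (ψ ∘ₗ φ) (hψ.comp hφ) rfl
        obtain ⟨y, rfl⟩ := hφ e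
        refine lt_of_le_of_ne (fun z hz ↦ ?_) fun h ↦ he0 ?_
        · rw [← hN, LinearMap.mem_ker] at hz
          simp [hz]
        · have : y ∈ LinearMap.ker (ψ ∘ₗ φ) := hψe
          rwa [← h, ← hN, LinearMap.mem_ker] at this
      have := hP.retracts
      exact ObjectProperty.IsStableUnderRetracts.of_biprod_left P
        (hP.extensions.prop_X₂_of_shortExact hS hPK (hT j (by omega)))

/-- An extension-closed subcategory containing `R` and the transposes `Tr Ω^i k` for `i < n`
contains `PD₀ⁿ(R)`. -/
lemma IsExtensionClosed.pdZeroLE_le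
    (hvan : ∀ i < t, ∀ x : Ext (resField R) (ModuleCat.of R R) i, x = 0)
    (hP : IsExtensionClosed P) (hR : P (ModuleCat.of R R)) {n : ℕ} (hn : n ≤ t)
    (hT : ∀ i < n, P (transpSeq R (i + 1))) : PDZeroLE R n ≤ P := by
  intro M hM
  obtain ⟨_, h₂, h₃⟩ := pdZeroLE_iff.1 hM
  exact hP.prop_of_ext_eq_zero hvan hR hn hT n 0 (zero_add n) M h₂ h₃ (by simp)

/-- A resolving subcategory containing a module of `PD₀ⁿ(R)` of projective dimension exactly `n`
contains `PD₀ⁿ(R)`. -/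
lemma IsResolving.pdZeroLE_le
    (hvan : ∀ i < t, ∀ x : Ext (resField R) (ModuleCat.of R R) i, x = 0)
    (hP : IsResolving P) {n : ℕ} (hn : n ≤ t) (M : ModuleCat.{u} R) (hPM : P M)
    (hM : PDZeroLE R n M) (hM' : n = 0 ∨ ¬ HasProjectiveDimensionLT M n) : PDZeroLE R n ≤ P := by
  have hR : P (ModuleCat.of R R) :=
    hP.projectives _ (inferInstanceAs (Module.Finite R R)) (inferInstanceAs (Module.Projective R R))
  induction n generalizing M with
  | zero => exact hP.toIsExtensionClosed.pdZeroLE_le hvan hR hn (by simp)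
  | succ n ih =>
    replace hM' := hM'.resolve_left (by omega)
    obtain ⟨_, hMpd, hMtor⟩ := pdZeroLE_iff.1 hM
    have hsyz := shortExact_syz M
    have hle : PDZeroLE R n ≤ P := by
      refine ih (by omega) (syz M) (hP.syzygies _ hsyz (finite_minCover M)
        (inferInstanceAs (Module.Projective R (MinCover M))) hPM) ⟨inferInstance,
        hsyz.hasProjectiveDimensionLT_X₁ (n + 1) inferInstance hMpd,
        ((isResolving_pdZeroLE R (n + 1)).syzygies _ hsyz (finite_minCover M)
          (inferInstanceAs (Module.Projective R (MinCover M))) hM).2.2⟩ (Or.inr fun h ↦ hM' ?_)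
      exact hsyz.hasProjectiveDimensionLT_X₃ n h inferInstance
    obtain ⟨h, hh⟩ := exists_map_from_transpSeq hvan hn M hMpd hM'
    obtain ⟨F, K, π, ι, w, hS, _, _, _⟩ := exists_shortExact_biprod h
    obtain ⟨-, hTpd, hTtor⟩ := pdZeroLE_iff.1 (pdZeroLE_transpSeq hvan hn)
    have hTF : PDZeroLE R (n + 1) (transpSeq R (n + 1) ⊞ F : ModuleCat.{u} R) := by
      have := (isExtensionClosed_pdZeroLE R (n + 1)).extensions
      have := (isExtensionClosed_pdZeroLE R (n + 1)).retracts
      exact (PDZeroLE R (n + 1)).prop_biprod (pdZeroLE_transpSeq hvan hn)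
        (pdZeroLE_of_projective _ F)
    obtain ⟨-, hTFpd, hTFtor⟩ := pdZeroLE_iff.1 hTF
    have hMpd' : HasProjectiveDimensionLT M (n + 2 + 1) :=
      hasProjectiveDimensionLT_of_ge _ (n + 2) _ (by omega)
    have hKpd : HasProjectiveDimensionLE K (n + 1) :=
      hS.hasProjectiveDimensionLT_X₁ (n + 2) hTFpd hMpd'
    -- Every class on `K` comes from `T_{n+1}`, where every class comes from `M`; classes from `M`
    -- die on `K`.
    have hKext : ∀ x : Ext K (ModuleCat.of R R) (n + 1), x = 0 := by
      intro x
      obtain ⟨y, rfl⟩ := exists_comp_ι_fst_eq hS x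
        (Ext.eq_zero_of_hasProjectiveDimensionLT _ (n + 2) le_rfl)
      obtain ⟨z, rfl⟩ := hh y
      exact comp_ι_fst_eq_zero w z
    have hPK : P K := hle K (pdZeroLE_iff.2
      ⟨‹_›, hasProjectiveDimensionLE_of_ext_eq_zero hKpd hKext, ExtPowerTorsion.X₁ hS hTFtor hMtor⟩)
    have hPT : P (transpSeq R (n + 1)) := by
      have := hP.retracts
      exact ObjectProperty.IsStableUnderRetracts.of_biprod_left P
        (hP.extensions.prop_X₂_of_shortExact hS hPK hPM)
    refine hP.toIsExtensionClosed.pdZeroLE_le hvan hR hn fun i hi ↦ ?_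
    rcases Nat.lt_succ_iff_lt_or_eq.1 hi with hi | rfl
    · exact hle _ (pdZeroLE_mono hi _ (pdZeroLE_transpSeq hvan (by omega)))
    · exact hPT

end Filtration


/-! ### Classification of the resolving subcategories -/

section Classification

variable {R : Type u} [CommRing R] [IsLocalRing R]

lemma addClosure_self_eq_pdZeroLE [IsNoetherianRing R] :
    addClosure (ModuleCat.of R R) = PDZeroLE R 0 := by
  ext M
  rw [addClosure_self_iff]
  refine ⟨fun ⟨_, _⟩ ↦ pdZeroLE_of_projective 0 M, fun h ↦ ⟨h.1, ?_⟩⟩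
  exact (IsProjective.iff_projective M).2
    ((projective_iff_hasProjectiveDimensionLE_zero M).2 h.2.1)

/-- The alternative `n = 0` accommodates the zero module, whose projective dimension is less than
`0`. -/
lemma exists_pdZeroLE_of_pdZero {M : ModuleCat.{u} R} (hM : PDZero R M) :
    ∃ n, PDZeroLE R n M ∧ (n = 0 ∨ ¬ HasProjectiveDimensionLT M n) := by
  classical
  have h := (projectiveDimension_ne_top_iff M).1 hM.2.1
  refine ⟨Nat.find h, ⟨hM.1, Nat.find_spec h, hM.2.2⟩, ?_⟩
  rcases hn : Nat.find h with _ | n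
  · exact Or.inl rfl
  · exact Or.inr (Nat.find_min h (m := n) (by omega))

lemma pdZeroLE_le_pdZero (n : ℕ) : PDZeroLE R n ≤ PDZero R :=
  fun M h ↦ ⟨h.1, (projectiveDimension_ne_top_iff M).2 ⟨n, h.2.1⟩, h.2.2⟩

variable [IsNoetherianRing R] {t : ℕ}

lemma exists_pdZeroLE_of_ringDepth (ht : ringDepth R = t) {M : ModuleCat.{u} R}
    (hM : PDZero R M) :
    ∃ n ≤ t, PDZeroLE R n M ∧ (n = 0 ∨ ¬ HasProjectiveDimensionLT M n) := by
  obtain ⟨n, hn, hn'⟩ := exists_pdZeroLE_of_pdZero hM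
  refine ⟨n, ?_, hn, hn'⟩
  rcases hn' with rfl | h
  · exact Nat.zero_le t
  · have := hn.1
    exact (le_depth_of_projectiveDimension ht n M hn.2.1 h).1

lemma pdZeroLE_depth_eq_pdZero (ht : ringDepth R = t) : PDZeroLE R t = PDZero R := by
  refine le_antisymm (pdZeroLE_le_pdZero t) fun M hM ↦ ?_
  obtain ⟨n, hn, hn', -⟩ := exists_pdZeroLE_of_ringDepth ht hM
  exact pdZeroLE_mono hn M hn'

lemma pdZeroLE_lt_succ (ht : ringDepth R = t) {n : ℕ} (hn : n < t) :
    PDZeroLE R n < PDZeroLE R (n + 1) := by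
  have hvan := (ext_resField_of_ringDepth ht).1
  refine lt_of_le_not_ge (pdZeroLE_mono n.le_succ) fun h ↦ ?_
  exact not_hasProjectiveDimensionLT_transpSeq hvan hn (h _ (pdZeroLE_transpSeq hvan hn)).2.1

lemma isResolving_and_le_pdZero_iff (ht : ringDepth R = t) (P : ObjectProperty (ModuleCat.{u} R)) :
    IsResolving P ∧ P ≤ PDZero R ↔ ∃ n ≤ t, P = PDZeroLE R n := by
  classical
  constructor
  · rintro ⟨hP, hle⟩
    have hex : ∃ n, P ≤ PDZeroLE R n := ⟨t, hle.trans (pdZeroLE_depth_eq_pdZero ht).ge⟩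
    refine ⟨Nat.find hex, Nat.find_min' hex (hle.trans (pdZeroLE_depth_eq_pdZero ht).ge),
      le_antisymm (Nat.find_spec hex) ?_⟩
    have hvan := (ext_resField_of_ringDepth ht).1
    -- By minimality of the bound some member of `P` attains it; when the bound is `0`, the module
    -- `R` serves.
    obtain ⟨M, hM, n, hn, hnM, hn', hfind⟩ : ∃ M, P M ∧ ∃ n ≤ t, PDZeroLE R n M ∧
        (n = 0 ∨ ¬ HasProjectiveDimensionLT M n) ∧ Nat.find hex ≤ n := by
      by_contra! h
      have hR : P (ModuleCat.of R R) := hP.projectives _ (inferInstanceAs (Module.Finite R R))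
        (inferInstanceAs (Module.Projective R R))
      rcases hm : Nat.find hex with _ | m
      · have h0 := pdZeroLE_of_projective 0 (ModuleCat.of R R)
        have := h _ hR 0 (Nat.zero_le t) h0 (Or.inl rfl)
        omega
      · refine Nat.find_min hex (m := m) (by omega) fun M hM ↦ ?_
        obtain ⟨n, hn, hnM, hn'⟩ := exists_pdZeroLE_of_ringDepth ht (hle M hM)
        have := h M hM n hn hnM hn'
        exact pdZeroLE_mono (by omega) M hnM
    exact (pdZeroLE_mono hfind).trans (hP.pdZeroLE_le hvan hn M hM hnM hn')
  · rintro ⟨n, -, rfl⟩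
    exact ⟨isResolving_pdZeroLE R n, pdZeroLE_le_pdZero n⟩

lemma pdZeroLE_eq_resClosure (ht : ringDepth R = t) {n : ℕ} (hn : n < t) :
    PDZeroLE R (n + 1) = resClosure (transp (nsyz n (resField R))) := by
  have hvan := (ext_resField_of_ringDepth ht).1
  have hT : PDZeroLE R (n + 1) (transpSeq R (n + 1)) := pdZeroLE_transpSeq hvan hn
  refine le_antisymm (fun M hM P hP hPT ↦ ?_) fun M hM ↦
    hM _ (isResolving_pdZeroLE R (n + 1)) hT
  exact hP.pdZeroLE_le hvan hn (transpSeq R (n + 1)) hPT hT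
    (Or.inr (not_hasProjectiveDimensionLT_transpSeq hvan hn)) M hM

lemma pdZeroLE_eq_extClosure (ht : ringDepth R = t) {n : ℕ} (hn : n ≤ t) :
    PDZeroLE R n = extClosure (ModuleCat.of R
      (R × DirectSum (Fin n) fun i ↦ transp (nsyz i (resField R)))) := by
  have hvan := (ext_resField_of_ringDepth ht).1
  refine le_antisymm (fun M hM P hP hPT ↦ ?_) fun M hM ↦ ?_
  · have hR : P (ModuleCat.of R R) := hP.prop_of_leftInverse (M := ModuleCat.of R R)
      (LinearMap.inl R R _) (LinearMap.fst R R _) (fun _ ↦ rfl) hPT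
    refine hP.pdZeroLE_le hvan hR hn (fun i hi ↦ ?_) M hM
    refine hP.prop_of_leftInverse (M := transp (nsyz i (resField R)))
      (LinearMap.inr R R _ ∘ₗ DirectSum.lof R (Fin n)
        (fun i ↦ transp (nsyz i (resField R))) ⟨i, hi⟩)
      (DirectSum.component R (Fin n) (fun i ↦ transp (nsyz i (resField R))) ⟨i, hi⟩ ∘ₗ
        LinearMap.snd R R _) (fun x ↦ ?_) hPT
    exact DirectSum.component.lof_self R (M := fun i : Fin n ↦ transp (nsyz i (resField R)))
      ⟨i, hi⟩ x
  · refine hM _ (isExtensionClosed_pdZeroLE R n) ?_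
    have hP := isExtensionClosed_pdZeroLE R n
    have hR := pdZeroLE_of_projective n (ModuleCat.of R R)
    let T : Fin n → ModuleCat.{u} R := fun i ↦ transp (nsyz i (resField R))
    let e := DirectSum.linearEquivFunOnFintype R (Fin n) fun i ↦ T i
    refine hP.prop_prod (M := ModuleCat.of R R)
      (N := ModuleCat.of R (DirectSum (Fin n) fun i ↦ T i))
      hR (hP.prop_of_leftInverse (M := ModuleCat.of R (DirectSum (Fin n) fun i ↦ T i))
        (N := ModuleCat.of R (∀ i, T i)) e.toLinearMap e.symm.toLinearMap
        e.symm_apply_apply (hP.prop_pi hR T fun i ↦ ?_))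
    exact pdZeroLE_mono (by omega) _ (pdZeroLE_transpSeq hvan (j := i + 1) (by omega))

end Classification

end ResolvingSubcat

theorem theorem2p1 (R : Type u) [CommRing R] [IsNoetherianRing R] [IsLocalRing R]
    (t : ℕ) (ht : ResolvingSubcat.ringDepth R = t) :
    -- the filtration
    (ResolvingSubcat.addClosure (ModuleCat.of R R) = ResolvingSubcat.PDZeroLE R 0 ∧
      (∀ n : ℕ, n < t → ResolvingSubcat.PDZeroLE R n < ResolvingSubcat.PDZeroLE R (n + 1)) ∧
      ResolvingSubcat.PDZeroLE R t = ResolvingSubcat.PDZero R) ∧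
    -- its members are exactly the resolving subcategories contained in `PD₀(R)`
    (∀ P : ObjectProperty (ModuleCat.{u} R),
      (ResolvingSubcat.IsResolving P ∧ P ≤ ResolvingSubcat.PDZero R) ↔
        ∃ n : ℕ, n ≤ t ∧ P = ResolvingSubcat.PDZeroLE R n) ∧
    -- the description of the members as closures
    (∀ n : ℕ, 1 ≤ n → n ≤ t →
      ResolvingSubcat.PDZeroLE R n =
        ResolvingSubcat.resClosure (ResolvingSubcat.transp
          (ResolvingSubcat.nsyz (n - 1) (ResolvingSubcat.resField R))) ∧
      ResolvingSubcat.resClosure (ResolvingSubcat.transp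
          (ResolvingSubcat.nsyz (n - 1) (ResolvingSubcat.resField R))) =
        ResolvingSubcat.extClosure (ModuleCat.of R
          (R × DirectSum (Fin n) fun i => ResolvingSubcat.transp
            (ResolvingSubcat.nsyz i (ResolvingSubcat.resField R))))) := by
  refine ⟨⟨ResolvingSubcat.addClosure_self_eq_pdZeroLE, fun n hn ↦
    ResolvingSubcat.pdZeroLE_lt_succ ht hn, ResolvingSubcat.pdZeroLE_depth_eq_pdZero ht⟩,
    ResolvingSubcat.isResolving_and_le_pdZero_iff ht, fun n h1 hn ↦ ?_⟩
  obtain ⟨n, rfl⟩ := Nat.exists_eq_add_of_le' h1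
  have hres := ResolvingSubcat.pdZeroLE_eq_resClosure ht hn
  exact ⟨hres, hres.symm.trans (ResolvingSubcat.pdZeroLE_eq_extClosure ht hn)⟩
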